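/- Consider hexagonal polyominoes: finite nonempty connected sets of cells of the honeycomb lattice (whose hexagons have two horizontal sides), taken up to translation. A polyomino is convex if it meets every line through centres of cells at angle $\pi/6$, $\pi/2$ or $5\pi/6$ with the horizontal axis in a connected set. Let $\mathrm r$ be the rotation by $\pi/3$, let $\mathrm h$ and $\mathrm v$ be the reflections in the horizontal and in the vertical axis, and let $D_{2,3}=\langle \mathrm r^3,\mathrm h\rangle$. In generating series, $x$ marks the number of columns, $q$ the area, $u$ the size of the first (leftmost) column, $v$ the size of the last column, and $t$ the half perimeter. From a column to the next, the upper profile grows (decreases) if its level rises (falls); this is weak if by half a hexagon, and strong if by more. The same holds for the lower profile, with a growth being a descent. With respect to a profile, the last column is in state $0$ if no decrease has occurred, in state $2$ if a strong decrease has occurred, and in state $1$ otherwise. Let $\mathrm{CS}_{00}(x,q,v,t)$, respectively $\mathrm{CS}_{11}(x,q,v,t)$, be the series of the $\mathrm h$-symmetric convex polyominoes whose last column is in state $0$, respectively $1$, for both profiles. Let $\mathrm{HS}_{11}(x,q,u,v,t)$ be the series of the $\mathrm h$-symmetric convex polyominoes both of whose profiles have only weak growths and weak decreases. Let $\mathrm{TS}(x,u,q)$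 be the series of symmetric stacks, that is, of the $\mathrm h$-symmetric convex polyominoes both of whose profiles decrease (weakly or strongly) from each column to the next. Put $\mathrm{CS}_{ii,k}=[v^k]\mathrm{CS}_{ii}$, $\mathrm{HS}_{11,k}=[u^k]\mathrm{HS}_{11}$, $\mathrm{TS}_k=[u^k]\mathrm{TS}$. Let $|\mathrm{Fix}(D_{2,3})|_{q,t}$ be the series of the convex polyominoes fixed (up to translation) by every element of $D_{2,3}$. Then: 1. $D_{2,3}=\langle \mathrm h,\mathrm v\rangle$, and a convex polyomino is fixed by $D_{2,3}$ if and only if it is $\mathrm v$-symmetric and its left half, including the central column, is $\mathrm h$-symmetric. 2. For $k\ge 1$, $\mathrm{CS}_{00,k}(x,q,t)=t^{2k}\,\mathrm{TS}_k(xt,q)$, where $\mathrm{TS}_k(x,q)=xq^k\,\mathrm{TS0}_{k-1}(x,q)$ with $\mathrm{TS0}_{-1}=\mathrm{TS0}_0=1$ and $\mathrm{TS0}_n=xq^n\,\mathrm{TS0}_{n-1}+\mathrm{TS0}_{n-2}$ for $n\ge1$. 3. $F=\mathrm{HS}_{11}$ is the unique solution in $\mathbb Z[x,u,v,t][[q]]$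 of $$F(v)=\frac{xquvt^3}{1-quvt^2}+xqvt^3\,F(vq)+\frac{xt}{qv}\left(F(vq)-v\left(\frac{F(vq)}{v}\right)_{v=0}\right),$$ where only the dependence on $v$ is displayed, $F(vq)$ is the result of substituting $vq$ for $v$, $(F(vq)/v)_{v=0}$ denotes $[v^1]F(vq)$, and the equation is understood after multiplication by $qv$. 4. $\displaystyle \mathrm{CS}_{11}(x,q,v,t)=\sum_{i\ge2}\frac1{t^{2i-2}}\,\mathrm{CS}_{00,i}(x,q,t)\,\mathrm{HS}_{11,i-1}(x,q,v,t).$ 5. $\displaystyle |\mathrm{Fix}(D_{2,3})|_{q,t}=\sum_{i\ge1}\frac{1}{q^i t^{2i+1}}\left(\mathrm{CS}_{00,i}(1,q^2,t^2)+\mathrm{CS}_{11,i}(1,q^2,t^2)\right).$ All these are identities of power series in $q$ with polynomial coefficients; in 4 and 5 the quotients are again such series and the sums converge $q$-adically. -/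

import Mathlib

namespace HexPoly

/-! ### The honeycomb lattice and its symmetries -/

/-- Hexagonal cells in axial coordinates.  All hexagons have two horizontal sides; the cell
`(a, b)` lies in the (vertical) column `a`, and, up to scaling, its centre is the point
`(√3 * a, 2 * b + a)` of the plane. -/
abbrev Cell := ℤ × ℤ

/-- The height of the centre of a cell, in units of half a hexagon. -/
def height (c : Cell) : ℤ := 2 * c.2 + c.1

/-- The displacements from a cell to the six cells sharing an edge with it. -/
def steps : Finset Cell := {(0, 1), (0, -1), (1, 0), (-1, 0), (1, -1), (-1, 1)}

/-- Two cells are adjacent when they share an edge. -/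
def hexGraph : SimpleGraph Cell where
  Adj c d := d - c ∈ steps
  symm := ⟨by
    intro c d hcd
    have key : ∀ e ∈ steps, -e ∈ steps := by decide
    simpa using key _ hcd⟩
  loopless := ⟨by
    intro c hc
    rw [sub_self] at hc
    exact absurd hc (by decide)⟩

/-- The clockwise rotation by `π / 3` about the centre of the cell `(0, 0)`. -/
def rot : (Cell ≃ₗ[ℤ] Cell) where
  toFun c := (c.1 + c.2, -c.1)
  invFun c := (-c.2, c.1 + c.2)
  left_inv c := by ext <;> simp
  right_inv c := by ext <;> simp
  map_add' c d := by ext <;> simp <;> ring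
  map_smul' n c := by ext <;> simp <;> ring

/-- The reflection in the horizontal axis. -/
def hRefl : (Cell ≃ₗ[ℤ] Cell) where
  toFun c := (c.1, -c.1 - c.2)
  invFun c := (c.1, -c.1 - c.2)
  left_inv c := by ext <;> simp
  right_inv c := by ext <;> simp
  map_add' c d := by ext <;> simp <;> ring
  map_smul' n c := by ext <;> simp <;> ring

/-- The reflection in the vertical axis. -/
def vRefl : (Cell ≃ₗ[ℤ] Cell) where
  toFun c := (-c.1, c.1 + c.2)
  invFun c := (-c.1, c.1 + c.2)
  left_inv c := by ext <;> simp
  right_inv c := by ext <;> simp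
  map_add' c d := by ext <;> simp <;> ring
  map_smul' n c := by ext <;> simp <;> ring

/-- The subgroup `D_{2,3} = ⟨r³, h⟩` of the symmetry group of the regular hexagon. -/
def D23 : Subgroup (Cell ≃ₗ[ℤ] Cell) := Subgroup.closure {rot ^ 3, hRefl}

/-! ### Sets of cells up to translation -/

/-- The translate of a set of cells. -/
def translate (s : Cell) (P : Finset Cell) : Finset Cell := P.map (Equiv.addLeft s).toEmbedding

theorem mem_translate {s c : Cell} {P : Finset Cell} : s + c ∈ translate s P ↔ c ∈ P := by
  simp [translate]

theorem exists_mem_translate {s : Cell} {P : Finset Cell} {p : Cell → Prop} :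
    (∃ c ∈ translate s P, p c) ↔ ∃ c ∈ P, p (s + c) := by
  rw [← (Equiv.addLeft s).exists_congr_right]
  simp only [Equiv.coe_addLeft, mem_translate]

theorem forall_mem_translate {s : Cell} {P : Finset Cell} {p : Cell → Prop} :
    (∀ c ∈ translate s P, p c) ↔ ∀ c ∈ P, p (s + c) := by
  rw [← (Equiv.addLeft s).forall_congr_right]
  simp only [Equiv.coe_addLeft, mem_translate]

theorem filter_translate {s : Cell} {P : Finset Cell} (p : Cell → Prop) [DecidablePred p]
    [DecidablePred fun c => p (s + c)] :
    (translate s P).filter p = translate s (P.filter fun c => p (s + c)) := by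
  ext c
  obtain ⟨c, rfl⟩ := (Equiv.addLeft s).surjective c
  simp only [Equiv.coe_addLeft, Finset.mem_filter, mem_translate]

/-- Two sets of cells are equivalent when one is a translate of the other. -/
def translationSetoid : Setoid (Finset Cell) where
  r P Q := ∃ s, Q = translate s P
  iseqv :=
    { refl := fun P => ⟨0, by ext c; simpa using (mem_translate (s := 0) (c := c) (P := P)).symm⟩
      symm := by
        rintro P _ ⟨s, rfl⟩
        refine ⟨-s, ?_⟩
        ext c
        rw [← mem_translate (s := s) (P := P), ← mem_translate (s := -s), neg_add_cancel_left]
      trans := by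
        rintro P _ _ ⟨s, rfl⟩ ⟨s', rfl⟩
        refine ⟨s' + s, ?_⟩
        ext c
        obtain ⟨c, rfl⟩ := (Equiv.addLeft (s' + s)).surjective c
        simp only [Equiv.coe_addLeft]
        rw [mem_translate, add_assoc, mem_translate, mem_translate] }

/-- Finite sets of cells, up to translation. -/
abbrev Shape := Quotient translationSetoid

/-- A translation invariant notion descends to shapes. -/
def Shape.lift {α : Sort*} (f : Finset Cell → α) (hf : ∀ s P, f (translate s P) = f P) :
    Shape → α :=
  Quotient.lift f (by rintro P _ ⟨s, rfl⟩; exact (hf s P).symm)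

/-- The action of the symmetries of the lattice on shapes. -/
def act (g : Cell ≃ₗ[ℤ] Cell) : Shape → Shape :=
  Quotient.map (fun P => P.map g.toEquiv.toEmbedding) (by
    rintro P _ ⟨s, rfl⟩
    refine ⟨g s, ?_⟩
    ext c
    simp [translate])

/-! ### Convex polyominoes and their parameters -/

/-- A polyomino is a (nonempty) finite connected set of cells. -/
def Connected (P : Finset Cell) : Prop := (hexGraph.induce (P : Set Cell)).Connected

/-- Convexity along the three column directions (of angles `π / 2`, `π / 6` and `5 * π / 6`): the
cells met on a line through centres of cells in one of these directions are consecutive. -/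
def ConvexCells (P : Finset Cell) : Prop :=
  ∀ e ∈ ({(0, 1), (1, 0), (1, -1)} : Finset Cell), ∀ c : Cell,
    Set.OrdConnected {k : ℤ | c + k • e ∈ P}

/-- The perimeter: the number of edges between a cell of `P` and a cell outside `P`. -/
def perimeter (P : Finset Cell) : ℕ := ∑ c ∈ P, (steps.filter fun e => c + e ∉ P).card

/-- The cells of the first (leftmost) column. -/
def firstColumn (P : Finset Cell) : Finset Cell := P.filter fun c => ∀ d ∈ P, c.1 ≤ d.1

/-- The cells of the last (rightmost) column. -/
def lastColumn (P : Finset Cell) : Finset Cell := P.filter fun c => ∀ d ∈ P, d.1 ≤ c.1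

/-- The left half of `P`, including the central column if there is one: the cells `c` with
`2 * c.1 ≤ min + max`, where `min` and `max` are the abscissae of the first and last columns. -/
def leftHalfCells (P : Finset Cell) : Finset Cell :=
  P.filter fun c => ∃ e ∈ P, ∀ d ∈ P, 2 * c.1 ≤ d.1 + e.1

/-- `c` is the top cell of its column in `P`. -/
def IsTop (P : Finset Cell) (c : Cell) : Prop := c ∈ P ∧ ∀ d ∈ P, d.1 = c.1 → d.2 ≤ c.2

/-- `c` is the bottom cell of its column in `P`. -/
def IsBottom (P : Finset Cell) (c : Cell) : Prop := c ∈ P ∧ ∀ d ∈ P, d.1 = c.1 → c.2 ≤ d.2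

/-- The growths of the upper profile, in half hexagons, from a column to the next one: positive
for a growth, negative for a decrease; weak if equal to `1` or `-1`, strong otherwise. -/
def upperGrowths (P : Finset Cell) : Set ℤ :=
  {z | ∃ c d, IsTop P c ∧ IsTop P d ∧ d.1 = c.1 + 1 ∧ z = height d - height c}

/-- The growths of the lower profile, for which a growth is a descent. -/
def lowerGrowths (P : Finset Cell) : Set ℤ :=
  {z | ∃ c d, IsBottom P c ∧ IsBottom P d ∧ d.1 = c.1 + 1 ∧ z = height c - height d}

theorem isTop_translate {s c : Cell} {P : Finset Cell} :
    IsTop (translate s P) (s + c) ↔ IsTop P c := by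
  simp only [IsTop, mem_translate, forall_mem_translate, Prod.fst_add, Prod.snd_add,
    add_right_inj, add_le_add_iff_left]

theorem isBottom_translate {s c : Cell} {P : Finset Cell} :
    IsBottom (translate s P) (s + c) ↔ IsBottom P c := by
  simp only [IsBottom, mem_translate, forall_mem_translate, Prod.fst_add, Prod.snd_add,
    add_right_inj, add_le_add_iff_left]

theorem height_add (c d : Cell) : height (c + d) = height c + height d := by
  simp [height]; ring

theorem upperGrowths_translate (s : Cell) (P : Finset Cell) :
    upperGrowths (translate s P) = upperGrowths P := by
  ext z
  simp only [upperGrowths, Set.mem_ofPred_eq]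
  rw [← (Equiv.addLeft s).exists_congr_right]
  refine exists_congr fun c => ?_
  rw [← (Equiv.addLeft s).exists_congr_right]
  refine exists_congr fun d => ?_
  simp [isTop_translate, height_add, add_assoc]

theorem lowerGrowths_translate (s : Cell) (P : Finset Cell) :
    lowerGrowths (translate s P) = lowerGrowths P := by
  ext z
  simp only [lowerGrowths, Set.mem_ofPred_eq]
  rw [← (Equiv.addLeft s).exists_congr_right]
  refine exists_congr fun c => ?_
  rw [← (Equiv.addLeft s).exists_congr_right]
  refine exists_congr fun d => ?_
  simp [isBottom_translate, height_add, add_assoc]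

theorem connected_translate (s : Cell) (P : Finset Cell) :
    Connected (translate s P) = Connected P := by
  let f : (hexGraph.induce (P : Set Cell)) ≃g (hexGraph.induce (translate s P : Set Cell)) :=
    { toEquiv := (Equiv.addLeft s).subtypeEquiv (by intro c; exact mem_translate.symm)
      map_rel_iff' := by
        intro c d
        have : s + (d : Cell) - (s + c) = d - c := by abel
        simp [hexGraph, Equiv.subtypeEquiv, this] }
  exact propext f.connected_iff.symm

theorem convexCells_translate (s : Cell) (P : Finset Cell) :
    ConvexCells (translate s P) = ConvexCells P := by
  refine propext (forall_congr' fun e => forall_congr' fun _ => ?_)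
  rw [← (Equiv.addLeft s).forall_congr_right]
  refine forall_congr' fun c => ?_
  simp only [Equiv.coe_addLeft, add_assoc, mem_translate]

theorem perimeter_translate (s : Cell) (P : Finset Cell) :
    perimeter (translate s P) = perimeter P := by
  have key : ∀ c e : Cell, (s + c + e ∈ translate s P) = (c + e ∈ P) := fun c e => by
    rw [add_assoc, mem_translate]
  rw [perimeter, translate, Finset.sum_map, ← translate]
  simp [perimeter, key]

theorem firstColumn_translate (s : Cell) (P : Finset Cell) :
    firstColumn (translate s P) = translate s (firstColumn P) := by
  classical
  simp only [firstColumn, filter_translate, forall_mem_translate, Prod.fst_add, add_le_add_iff_left]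

theorem lastColumn_translate (s : Cell) (P : Finset Cell) :
    lastColumn (translate s P) = translate s (lastColumn P) := by
  classical
  simp only [lastColumn, filter_translate, forall_mem_translate, Prod.fst_add, add_le_add_iff_left]

theorem leftHalfCells_translate (s : Cell) (P : Finset Cell) :
    leftHalfCells (translate s P) = translate s (leftHalfCells P) := by
  classical
  have key : ∀ a b c : ℤ, 2 * (s.1 + a) ≤ s.1 + b + (s.1 + c) ↔ 2 * a ≤ b + c := by
    intros; constructor <;> intro _ <;> linarith
  simp only [leftHalfCells, filter_translate, forall_mem_translate, exists_mem_translate,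
    Prod.fst_add, key]

namespace Shape

/-- Convex polyominoes, up to translation. -/
def IsConvexPolyomino : Shape → Prop :=
  lift (fun P => Connected P ∧ ConvexCells P) fun s P => by
    rw [connected_translate, convexCells_translate]

/-- The number of cells. -/
def area : Shape → ℕ := lift Finset.card fun s P => by simp [translate]

/-- The half perimeter (the perimeter is even). -/
def halfPerimeter : Shape → ℕ :=
  lift (fun P => perimeter P / 2) fun s P => by rw [perimeter_translate]

/-- The number of columns. -/
def width : Shape → ℕ :=
  lift (fun P => (P.image Prod.fst).card) fun s P => by
    have h : (translate s P).image Prod.fst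
        = (P.image Prod.fst).map (Equiv.addLeft s.1).toEmbedding := by
      rw [translate, Finset.map_eq_image, Finset.map_eq_image, Finset.image_image,
        Finset.image_image]
      rfl
    rw [h, Finset.card_map]

/-- The size of the first column. -/
def firstSize : Shape → ℕ :=
  lift (fun P => (firstColumn P).card) fun s P => by
    rw [firstColumn_translate, translate, Finset.card_map]

/-- The size of the last column. -/
def lastSize : Shape → ℕ :=
  lift (fun P => (lastColumn P).card) fun s P => by
    rw [lastColumn_translate, translate, Finset.card_map]

/-- The left half, including the central column. -/
def leftHalf : Shape → Shape :=
  lift (fun P => (Quotient.mk translationSetoid (leftHalfCells P) : Shape)) fun s P =>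
    (Quotient.sound (s := translationSetoid) (show ∃ s', leftHalfCells (translate s P)
      = translate s' (leftHalfCells P) from ⟨s, leftHalfCells_translate s P⟩)).symm

/-- The growths of the upper profile of a shape. -/
def upper : Shape → Set ℤ := lift upperGrowths upperGrowths_translate

/-- The growths of the lower profile of a shape. -/
def lower : Shape → Set ℤ := lift lowerGrowths lowerGrowths_translate

end Shape

/-- The state of the last column with respect to a profile with the given growths: it is `2` once a
strong decrease has occurred, otherwise `1` once a (weak) decrease has occurred, otherwise `0`. -/
noncomputable def lastState (S : Set ℤ) : ℕ :=
  open Classical in if ∃ z ∈ S, z < -1 then 2 else if ∃ z ∈ S, z < 0 then 1 else 0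

/-- The class `C_{ij}` of convex polyominoes whose last column is in the state `(i, j)`. -/
def classC (i j : ℕ) : Set Shape :=
  {P | P.IsConvexPolyomino ∧ lastState P.upper = i ∧ lastState P.lower = j}

/-- The class `H₁₁` of convex polyominoes whose upper and lower profiles are both oscillating: all
growths and decreases are weak. -/
def classH11 : Set Shape :=
  {P | P.IsConvexPolyomino ∧ (∀ z ∈ P.upper, z = 1 ∨ z = -1) ∧ ∀ z ∈ P.lower, z = 1 ∨ z = -1}

/-- The class `T` of stack polyominoes (viewed sideways, the first column being the base): both
profiles decrease, weakly or strongly, from each column to the next. -/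
def classT : Set Shape :=
  {P | P.IsConvexPolyomino ∧ (∀ z ∈ P.upper, z < 0) ∧ ∀ z ∈ P.lower, z < 0}

/-- The `h`-symmetric shapes. -/
def hSymmetric : Set Shape := {P | act hRefl P = P}

/-- The class `Fix(D_{2,3})` of convex polyominoes with all the symmetries of `D_{2,3}`. -/
def fixD23 : Set Shape := {P | P.IsConvexPolyomino ∧ ∀ g ∈ D23, act g P = P}

/-! ### Generating series

Series are power series in `q` whose coefficients are polynomials in `x`, `u`, `v`, `t`: there are
finitely many polyominoes of given area, up to translation. -/

/-- The variables other than `q`. -/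
inductive Var
  | x | u | v | t

/-- The ring `ℤ[x, u, v, t][[q]]`. -/
abbrev Ser := PowerSeries (MvPolynomial Var ℤ)

/-- The variable `q`. -/
noncomputable def q : Ser := PowerSeries.X

/-- The variables `x`, `u`, `v`, `t` as series. -/
noncomputable def var (i : Var) : Ser := PowerSeries.C (MvPolynomial.X i)

/-- The generating series of a class of shapes: `q` marks the area, and `w` is the contribution of
the other variables to the weight. -/
noncomputable def genSeries (A : Set Shape) (w : Shape → MvPolynomial Var ℤ) : Ser :=
  PowerSeries.mk fun n => ∑ᶠ (P : Shape) (_ : P ∈ A ∧ P.area = n), w P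

/-- The coefficient `[i^k] f`, a series in the remaining variables. -/
noncomputable def extract (i : Var) (k : ℕ) (f : Ser) : Ser :=
  PowerSeries.mk fun n =>
    open Classical in
    ∑ d ∈ (PowerSeries.coeff n f).support with d i = k,
      MvPolynomial.monomial (d.erase i) ((PowerSeries.coeff n f).coeff d)

/-- The series `∑ₙ fₙ(a_x, a_u, a_v, a_t) q^(e * n)` obtained from `f = ∑ₙ fₙ(x, u, v, t) q^n` by
substituting the series `a_i` for the variables `i` and `q ^ e` for `q`, for `e ≥ 1` (so that the
terms with `n > N` do not contribute to the coefficient of `q ^ N`). -/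
noncomputable def substitute (a : Var → Ser) (e : ℕ) (f : Ser) : Ser :=
  PowerSeries.mk fun N => ∑ n ∈ Finset.range (N + 1),
    PowerSeries.coeff N (MvPolynomial.aeval a (PowerSeries.coeff n f) * q ^ (e * n))

/-- The sum of the formal series `∑_{i ∈ s} F i` is `S`: the family is summable, in the sense that
each power of `q` occurs in finitely many of its members, and `S` is its sum. -/
def HasFormalSum (s : Set ℕ) (F : ℕ → Ser) (S : Ser) : Prop :=
  ∀ n, {i ∈ s | PowerSeries.coeff n (F i) ≠ 0}.Finite ∧
    PowerSeries.coeff n S = ∑ᶠ i ∈ s, PowerSeries.coeff n (F i)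

/-- The substitution `v ↦ v q`. -/
noncomputable def substVQ : Ser → Ser :=
  substitute (fun | .x => var .x | .u => var .u | .v => var .v * q | .t => var .t) 1

/-- The substitution `x ↦ x t`. -/
noncomputable def substXT : Ser → Ser :=
  substitute (fun | .x => var .x * var .t | .u => var .u | .v => var .v | .t => var .t) 1

/-- The substitution `x ↦ 1`, `q ↦ q²`, `t ↦ t²`. -/
noncomputable def substOneSqSq : Ser → Ser :=
  substitute (fun | .x => 1 | .u => var .u | .v => var .v | .t => var .t ^ 2) 2

open MvPolynomial in
/-- `CS₀₀(x, q, v, t)`. -/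
noncomputable def CS00 : Ser :=
  genSeries (classC 0 0 ∩ hSymmetric) fun P =>
    X .x ^ P.width * X .v ^ P.lastSize * X .t ^ P.halfPerimeter

open MvPolynomial in
/-- `CS₁₁(x, q, v, t)`. -/
noncomputable def CS11 : Ser :=
  genSeries (classC 1 1 ∩ hSymmetric) fun P =>
    X .x ^ P.width * X .v ^ P.lastSize * X .t ^ P.halfPerimeter

open MvPolynomial in
/-- `HS₁₁(x, q, u, v, t)`. -/
noncomputable def HS11 : Ser :=
  genSeries (classH11 ∩ hSymmetric) fun P =>
    X .x ^ P.width * X .u ^ P.firstSize * X .v ^ P.lastSize * X .t ^ P.halfPerimeter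

open MvPolynomial in
/-- `TS(x, u, q)`, the series of symmetric stacks. -/
noncomputable def TS : Ser :=
  genSeries (classT ∩ hSymmetric) fun P => X .x ^ P.width * X .u ^ P.firstSize

open MvPolynomial in
/-- `|Fix(D_{2,3})|_{q,t}`. -/
noncomputable def fixSeries : Ser := genSeries fixD23 fun P => X .t ^ P.halfPerimeter

/-- The polynomials `TS0_n(x, q)`, with `TS0_{-1} = TS0_0 = 1` and
`TS0_n = x q^n TS0_{n-1} + TS0_{n-2}`. -/
noncomputable def TS0 : ℕ → Ser
  | 0 => 1
  | 1 => var .x * q + 1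
  | n + 2 => var .x * q ^ (n + 2) * TS0 (n + 1) + TS0 n

/-- The functional equation
`F(v) = xquvt³ / (1 - quvt²) + xqvt³ F(vq) + (xt / (qv)) (F(vq) - v (F(vq) / v)_{v = 0})`,
multiplied by `qv`. -/
def FunctionalEquation (F : Ser) : Prop :=
  q * var .v * F =
    q * var .v * (var .x * q * var .u * var .v * var .t ^ 3 *
        PowerSeries.invOfUnit (1 - q * var .u * var .v * var .t ^ 2) 1)
      + q * var .v * (var .x * q * var .v * var .t ^ 3 * substVQ F)
      + var .x * var .t * (substVQ F - var .v * extract .v 1 (substVQ F))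

end HexPoly

/-! An `h`-symmetric convex polyomino is determined up to translation by the list of its column
sizes. If its axis is placed at height zero, the column at abscissa `x` with `n` cells consists of
the cells of height less than `n` in absolute value, and `n + x` is odd. Hence consecutive sizes
have an odd difference, and this difference is the growth of both profiles. A line in an oblique
direction has height `ε * x + 2 * m` with `ε = ±1`. It meets the polyomino in a connected set for
every `m` exactly when, for both signs, the size minus `ε * x` never rises again once it has fallen.
For odd differences this is the condition `Unimodal`. The half perimeter is the number of columns
plus twice the total decrease. `exists_shapeOf`, `shapeOf_injOn` and `convexCells_cells_iff` turn
every class of the theorem into a set of lists (`bijOn_shapeOf`).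

What remains is the combinatorics of lists. A decreasing list is built column by column, with parity
forcing the recurrence of `TS0` (`hasSum_TS0`). An oscillating list is a single column, or arises
from a shorter one by adding in front a column with one cell more or one cell less (`oscSizes_eq`).
A list with a weak decrease and no strong one is cut uniquely at its first decrease into an
increasing part and an oscillating part (`bijOn_split`). A fixed polyomino is a palindromic list. It
has a central column, since the difference of two equal middle columns would be zero, and its left
half ends in state 0 or 1, since a strong decrease there would be reflected into a later strong
growth (`bijOn_palindromes`, `halves_eq`).

The passage to series is topological: each series is the sum of a family of monomials indexed by
lists, for the product topology with discrete coefficients. Bijections, extraction and substitution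
act on such sums term by term, and each identity follows by uniqueness of the sum. The functional
equation has one solution because it determines each coefficient of `q` from the preceding ones
(`eq_zero_of_functionalEquation`). -/

namespace HexPoly

open Set
open scoped PowerSeries.WithPiTopology

/-! ### Locally finite sums of monomials -/

/-- The polynomial coefficients carry the discrete topology. -/
instance : TopologicalSpace (MvPolynomial Var ℤ) := ⊥

instance : DiscreteTopology (MvPolynomial Var ℤ) := ⟨rfl⟩

/-- Regularity is used to regroup a sum by fibres and to multiply two sums. -/
instance : RegularSpace Ser :=
  inferInstanceAs (RegularSpace ((Unit →₀ ℕ) → MvPolynomial Var ℤ))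

/-- Applied to each coefficient of `q`, this identifies topological sums with the purely algebraic
`HasFormalSum` and with the `finsum` in `genSeries`. -/
theorem hasSum_discrete_iff {ι M : Type*} [AddCommGroup M] [TopologicalSpace M]
    [DiscreteTopology M] {f : ι → M} {a : M} :
    HasSum f a ↔ f.support.Finite ∧ a = ∑ᶠ i, f i := by
  constructor
  · intro h
    have hf := h.summable.hasFiniteSupport_of_discreteTopology
    exact ⟨hf, h.unique (tsum_eq_finsum (L := SummationFilter.unconditional ι) hf ▸ h.summable.hasSum)⟩
  · rintro ⟨hf, rfl⟩
    rw [← tsum_eq_finsum (L := SummationFilter.unconditional ι) hf]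
    exact (summable_of_hasFiniteSupport hf).hasSum

theorem hasFormalSum_of_hasSum {s : Set ℕ} {F : ℕ → Ser} {S : Ser}
    (h : HasSum (s.indicator F) S) : HasFormalSum s F S := by
  intro n
  rw [PowerSeries.WithPiTopology.hasSum_iff_hasSum_coeff] at h
  obtain ⟨h1, h2⟩ := hasSum_discrete_iff.1 (h n)
  have key : (fun i => PowerSeries.coeff n (s.indicator F i))
      = s.indicator fun i => PowerSeries.coeff n (F i) := by
    ext1 i
    by_cases hi : i ∈ s <;> simp [hi]
  rw [key] at h1 h2
  refine ⟨h1.subset ?_, ?_⟩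
  · rintro i ⟨hi, hne⟩
    simpa [hi] using hne
  · rw [h2, finsum_mem_def]

/-- Every weight-preserving bijection of the proof acts on generating series through this transport.
-/
theorem hasSum_bijOn {ι κ M : Type*} [AddCommMonoid M] [TopologicalSpace M] {B : Set ι} {A : Set κ}
    {φ : ι → κ} (h : BijOn φ B A) {f : ι → M} {g : κ → M} (hfg : ∀ i ∈ B, g (φ i) = f i) {S : M} :
    HasSum (B.indicator f) S ↔ HasSum (A.indicator g) S := by
  rw [← hasSum_subtype_iff_indicator, ← hasSum_subtype_iff_indicator,
    ← (BijOn.equiv φ h).hasSum_iff]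
  have : (g ∘ (↑) : A → M) ∘ (BijOn.equiv φ h) = f ∘ (↑) := by
    ext ⟨i, hi⟩
    exact hfg i hi
  rw [this]

/-- The series `∑_{i ∈ B} w i * q ^ a i`. -/
noncomputable def series {ι : Type*} (B : Set ι) (a : ι → ℕ) (w : ι → MvPolynomial Var ℤ) : Ser :=
  PowerSeries.mk fun n => ∑ᶠ (i : ι) (_ : i ∈ B ∧ a i = n), w i

theorem hasSum_series {ι : Type*} {B : Set ι} {a : ι → ℕ} {w : ι → MvPolynomial Var ℤ}
    (hfin : ∀ n, {i | i ∈ B ∧ a i = n}.Finite) :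
    HasSum (B.indicator fun i => PowerSeries.monomial (a i) (w i)) (series B a w) := by
  classical
  rw [PowerSeries.WithPiTopology.hasSum_iff_hasSum_coeff]
  intro n
  have key : (fun i => PowerSeries.coeff n (B.indicator (fun i => PowerSeries.monomial (a i) (w i)) i))
      = {i | i ∈ B ∧ a i = n}.indicator w := by
    ext1 i
    by_cases hi : i ∈ B <;> by_cases hn : a i = n
    · simp [hi, hn]
    · simp [hi, hn, PowerSeries.coeff_monomial, Ne.symm hn]
    · simp [hi]
    · simp [hi]
  rw [key, hasSum_discrete_iff]
  refine ⟨(hfin n).subset (Set.support_indicator_subset), ?_⟩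
  rw [series, PowerSeries.coeff_mk]
  exact finsum_mem_def {i | i ∈ B ∧ a i = n} w

theorem hasSum_genSeries {ι : Type*} {A : Set Shape} {B : Set ι} {φ : ι → Shape}
    (h : BijOn φ B A) {a : ι → ℕ} (ha : ∀ i ∈ B, (φ i).area = a i)
    (hfin : ∀ n, {i | i ∈ B ∧ a i = n}.Finite) {w : Shape → MvPolynomial Var ℤ}
    {w' : ι → MvPolynomial Var ℤ} (hw : ∀ i ∈ B, w (φ i) = w' i) :
    HasSum (B.indicator fun i => PowerSeries.monomial (a i) (w' i)) (genSeries A w) := by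
  rw [hasSum_bijOn h (g := fun P => PowerSeries.monomial P.area (w P))
    (fun i hi => by rw [ha i hi, hw i hi])]
  refine hasSum_series fun n => ((hfin n).image φ).subset ?_
  rintro P ⟨hP, hn⟩
  obtain ⟨i, hi, rfl⟩ := h.surjOn hP
  exact ⟨i, ⟨hi, by rw [← ha i hi, hn]⟩, rfl⟩

/-! ### Monomials -/

/-- The exponent of `x ^ a * u ^ b * v ^ c * t ^ d`. -/
noncomputable def expo (a b c d : ℕ) : Var →₀ ℕ :=
  Finsupp.single .x a + Finsupp.single .u b + Finsupp.single .v c + Finsupp.single .t d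

/-- The monomial `q ^ n * x ^ a * u ^ b * v ^ c * t ^ d`. -/
noncomputable def mon (n a b c d : ℕ) : Ser :=
  PowerSeries.monomial n (MvPolynomial.monomial (expo a b c d) 1)

theorem expo_add (a b c d a' b' c' d' : ℕ) :
    expo a b c d + expo a' b' c' d' = expo (a + a') (b + b') (c + c') (d + d') := by
  simp only [expo, Finsupp.single_add]
  abel

theorem expo_x (a b c d : ℕ) : expo a b c d .x = a := by simp [expo]
theorem expo_u (a b c d : ℕ) : expo a b c d .u = b := by simp [expo]
theorem expo_v (a b c d : ℕ) : expo a b c d .v = c := by simp [expo]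
theorem expo_t (a b c d : ℕ) : expo a b c d .t = d := by simp [expo]

theorem expo_ext {d d' : Var →₀ ℕ} (hx : d .x = d' .x) (hu : d .u = d' .u) (hv : d .v = d' .v)
    (ht : d .t = d' .t) : d = d' := by
  ext i
  cases i <;> assumption

theorem mon_mul (n a b c d n' a' b' c' d' : ℕ) : mon n a b c d * mon n' a' b' c' d'
    = mon (n + n') (a + a') (b + b') (c + c') (d + d') := by
  rw [mon, mon, PowerSeries.monomial_mul_monomial, MvPolynomial.monomial_mul, expo_add, mul_one, mon]

theorem mon_zero : mon 0 0 0 0 0 = 1 := by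
  simp [mon, expo]

theorem mon_pow (n a b c d k : ℕ) :
    mon n a b c d ^ k = mon (k * n) (k * a) (k * b) (k * c) (k * d) := by
  induction k with
  | zero => simp [mon_zero]
  | succ k ih => rw [pow_succ, ih, mon_mul]; congr 1 <;> ring

theorem q_eq : q = mon 1 0 0 0 0 := by
  simp [mon, q, expo, PowerSeries.X_eq]

theorem var_x : var .x = mon 0 1 0 0 0 := by
  simp [mon, var, expo, MvPolynomial.X]

theorem var_u : var .u = mon 0 0 1 0 0 := by
  simp [mon, var, expo, MvPolynomial.X]

theorem var_v : var .v = mon 0 0 0 1 0 := by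
  simp [mon, var, expo, MvPolynomial.X]

theorem var_t : var .t = mon 0 0 0 0 1 := by
  simp [mon, var, expo, MvPolynomial.X]

theorem mon_eq (n a b c d : ℕ) :
    mon n a b c d = q ^ n * (var .x ^ a * var .u ^ b * var .v ^ c * var .t ^ d) := by
  simp only [q_eq, var_x, var_u, var_v, var_t, mon_pow, mon_mul]
  congr 1 <;> ring

theorem X_pow_eq (a b c d : ℕ) :
    (MvPolynomial.X .x ^ a * MvPolynomial.X .u ^ b * MvPolynomial.X .v ^ c * MvPolynomial.X .t ^ d :
      MvPolynomial Var ℤ) = MvPolynomial.monomial (expo a b c d) 1 := by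
  simp only [MvPolynomial.X_pow_eq_monomial, MvPolynomial.monomial_mul, expo, mul_one]

/-! ### Extraction and substitution -/

theorem coeff_extract (i : Var) (k : ℕ) (f : Ser) (n : ℕ) (d : Var →₀ ℕ) :
    (PowerSeries.coeff n (extract i k f)).coeff d
      = if d i = 0 then (PowerSeries.coeff n f).coeff (d + Finsupp.single i k) else 0 := by
  classical
  rw [extract, PowerSeries.coeff_mk, MvPolynomial.coeff_sum]
  simp only [MvPolynomial.coeff_monomial]
  split_ifs with h
  · have key : ∀ e : Var →₀ ℕ, e i = k → (e.erase i = d ↔ e = d + Finsupp.single i k) := by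
      intro e he
      constructor
      · rintro rfl
        rw [← he, Finsupp.erase_add_single]
      · rintro rfl
        ext j
        by_cases hj : j = i
        · subst hj; simp [h]
        · simp [hj]
    rw [Finset.sum_congr rfl (g := fun e => if e = d + Finsupp.single i k then
      (PowerSeries.coeff n f).coeff e else 0)]
    · rw [Finset.sum_ite_eq']
      simp only [Finset.mem_filter, MvPolynomial.mem_support_iff]
      by_cases h0 : (PowerSeries.coeff n f).coeff (d + Finsupp.single i k) = 0 <;> simp [h0, h]
    · intro e he
      simp only [key e (Finset.mem_filter.1 he).2]
  · refine Finset.sum_eq_zero fun e he => if_neg ?_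
    rintro rfl
    simp at h

theorem extract_add (i : Var) (k : ℕ) (f g : Ser) :
    extract i k (f + g) = extract i k f + extract i k g := by
  ext n d
  rw [map_add, MvPolynomial.coeff_add]
  simp only [coeff_extract]
  split_ifs <;> simp

/-- Extraction as an additive map. -/
noncomputable def extractHom (i : Var) (k : ℕ) : Ser →+ Ser :=
  AddMonoidHom.mk' (extract i k) (extract_add i k)

theorem substitute_add (a : Var → Ser) (e : ℕ) (f g : Ser) :
    substitute a e (f + g) = substitute a e f + substitute a e g := by
  ext1 n
  simp only [substitute, PowerSeries.coeff_mk, map_add, add_mul, Finset.sum_add_distrib]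

/-- Substitution as an additive map. -/
noncomputable def substituteHom (a : Var → Ser) (e : ℕ) : Ser →+ Ser :=
  AddMonoidHom.mk' (substitute a e) (substitute_add a e)

/-! ### Continuity of extraction and substitution -/

theorem continuous_ser {X : Type*} [TopologicalSpace X] {φ : X → Ser}
    (h : ∀ n, Continuous fun x => PowerSeries.coeff n (φ x)) : Continuous φ := by
  refine continuous_pi fun d => ?_
  have := h (d ())
  rwa [show (fun x => PowerSeries.coeff (d ()) (φ x)) = fun x => φ x d from ?_] at this
  ext1 x
  rw [PowerSeries.coeff_def (by rfl)]
  rfl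

theorem continuous_extract (i : Var) (k : ℕ) : Continuous (extract i k) :=
  continuous_ser fun n => by
    have : (fun f => PowerSeries.coeff n (extract i k f)) = (fun p : MvPolynomial Var ℤ =>
        PowerSeries.coeff n (extract i k (PowerSeries.monomial n p))) ∘ PowerSeries.coeff n := by
      ext f d
      simp only [Function.comp, coeff_extract, PowerSeries.coeff_monomial_same]
    rw [this]
    exact continuous_of_discreteTopology.comp (PowerSeries.WithPiTopology.continuous_coeff _ n)

/-- The coefficient of `q ^ n` in the result depends only on the coefficients of index at most `n`,
and each of these has a discrete range. -/
theorem continuous_substitute (a : Var → Ser) (e : ℕ) : Continuous (substitute a e) :=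
  continuous_ser fun n => by
    simp only [substitute, PowerSeries.coeff_mk]
    refine continuous_finsetSum _ fun m _ => ?_
    exact (continuous_of_discreteTopology (f := fun p : MvPolynomial Var ℤ =>
      PowerSeries.coeff n (MvPolynomial.aeval a p * q ^ (e * m)))).comp
      (PowerSeries.WithPiTopology.continuous_coeff _ m)

theorem extract_zero (i : Var) (k : ℕ) : extract i k 0 = 0 := (extractHom i k).map_zero

theorem substitute_zero (a : Var → Ser) (e : ℕ) : substitute a e 0 = 0 :=
  (substituteHom a e).map_zero

theorem hasSum_extract {ι : Type*} {f : ι → Ser} {S : Ser} (h : HasSum f S) (i : Var) (k : ℕ) :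
    HasSum (fun l => extract i k (f l)) (extract i k S) :=
  h.map (extractHom i k) (continuous_extract i k)

theorem hasSum_substitute {ι : Type*} {f : ι → Ser} {S : Ser} (h : HasSum f S) (a : Var → Ser)
    (e : ℕ) : HasSum (fun l => substitute a e (f l)) (substitute a e S) :=
  h.map (substituteHom a e) (continuous_substitute a e)

theorem extract_mon (i : Var) (k n : ℕ) (d : Var →₀ ℕ) :
    extract i k (PowerSeries.monomial n (MvPolynomial.monomial d 1))
      = if d i = k then PowerSeries.monomial n (MvPolynomial.monomial (d.erase i) 1) else 0 := by
  classical
  ext m e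
  rw [coeff_extract]
  by_cases hm : m = n
  · subst hm
    split_ifs with h1 h2 h2
    · simp only [PowerSeries.coeff_monomial_same, MvPolynomial.coeff_monomial]
      congr 1
      rw [← h2, eq_iff_iff]
      constructor
      · intro h
        rw [h]
        ext j
        by_cases hj : j = i
        · subst hj; simp [h1]
        · simp [hj]
      · rintro rfl
        rw [Finsupp.erase_add_single]
    · simp only [PowerSeries.coeff_monomial_same, MvPolynomial.coeff_monomial]
      rw [if_neg]
      · simp
      · rintro rfl
        simp [h1] at h2
    · simp only [PowerSeries.coeff_monomial_same, MvPolynomial.coeff_monomial]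
      rw [if_neg]
      rintro rfl
      simp at h1
    · simp
  · split_ifs <;> simp [PowerSeries.coeff_monomial, hm]

theorem extract_u_mon (k n a b c d : ℕ) :
    extract .u k (mon n a b c d) = if b = k then mon n a 0 c d else 0 := by
  rw [mon, extract_mon, expo_u, mon, show (expo a b c d).erase .u = expo a 0 c d from ?_]
  exact expo_ext (by simp [expo]) (by simp [expo]) (by simp [expo]) (by simp [expo])

theorem extract_v_mon (k n a b c d : ℕ) :
    extract .v k (mon n a b c d) = if c = k then mon n a b 0 d else 0 := by
  rw [mon, extract_mon, expo_v, mon, show (expo a b c d).erase .v = expo a b 0 d from ?_]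
  exact expo_ext (by simp [expo]) (by simp [expo]) (by simp [expo]) (by simp [expo])

theorem substitute_monomial (s : Var → Ser) {e : ℕ} (he : 1 ≤ e) (n : ℕ) (p : MvPolynomial Var ℤ) :
    substitute s e (PowerSeries.monomial n p) = MvPolynomial.aeval s p * q ^ (e * n) := by
  classical
  ext1 N
  rw [substitute, PowerSeries.coeff_mk, Finset.sum_eq_single n]
  · rw [PowerSeries.coeff_monomial_same]
  · intro m _ hm
    simp [PowerSeries.coeff_monomial, hm]
  -- The index `n` is missing from the range only if `N < n`. Then `N < e * n`, because `1 ≤ e`, and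
  -- the coefficient vanishes anyway.
  · intro hN
    rw [PowerSeries.coeff_monomial_same, q, PowerSeries.coeff_mul_X_pow', if_neg]
    have : n ≤ e * n := Nat.le_mul_of_pos_left n he
    simp at hN
    omega

theorem substitute_mon (s : Var → Ser) {e : ℕ} (he : 1 ≤ e) (n a b c d : ℕ) :
    substitute s e (mon n a b c d)
      = q ^ (e * n) * (s .x ^ a * s .u ^ b * s .v ^ c * s .t ^ d) := by
  rw [mon, substitute_monomial s he, ← X_pow_eq, mul_comm]
  simp

theorem substVQ_mon (n a b c d : ℕ) : substVQ (mon n a b c d) = mon (n + c) a b c d := by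
  rw [substVQ, substitute_mon _ le_rfl, mon_eq]
  ring

theorem substXT_mon (n a b c d : ℕ) : substXT (mon n a b c d) = mon n a b c (a + d) := by
  rw [substXT, substitute_mon _ le_rfl, mon_eq]
  ring

theorem substOneSqSq_mon (n a b c d : ℕ) :
    substOneSqSq (mon n a b c d) = mon (2 * n) 0 b c (2 * d) := by
  rw [substOneSqSq, substitute_mon _ one_le_two, mon_eq]
  ring

/-! ### Operations on families with a sum -/

theorem HasSum.indicator_map {ι : Type*} {A : Set ι} {f g : ι → Ser} {S : Ser} {φ : Ser → Ser}
    (hφ : ∀ {f : ι → Ser} {S : Ser}, HasSum f S → HasSum (fun l => φ (f l)) (φ S)) (h0 : φ 0 = 0)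
    (h : HasSum (A.indicator f) S) (hfg : ∀ l ∈ A, φ (f l) = g l) :
    HasSum (A.indicator g) (φ S) := by
  convert hφ h using 1
  ext1 l
  by_cases hl : l ∈ A
  · simp [hl, hfg l hl]
  · simp [hl, h0]

theorem HasSum.indicator_mul_left {ι : Type*} {A : Set ι} {f g : ι → Ser} {S : Ser} (c : Ser)
    (h : HasSum (A.indicator f) S) (hfg : ∀ l ∈ A, c * f l = g l) :
    HasSum (A.indicator g) (c * S) :=
  HasSum.indicator_map (φ := fun s => c * s) (fun h => h.mul_left c) (mul_zero c) h hfg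

theorem HasSum.indicator_substitute {ι : Type*} {A : Set ι} {f g : ι → Ser} {S : Ser}
    (s : Var → Ser) (e : ℕ) (h : HasSum (A.indicator f) S)
    (hfg : ∀ l ∈ A, substitute s e (f l) = g l) :
    HasSum (A.indicator g) (substitute s e S) :=
  HasSum.indicator_map (fun h => hasSum_substitute h s e) (substitute_zero s e) h hfg

/-- Extraction kills every monomial with the wrong exponent, so it restricts the index set to one
value of the statistic `key`. -/
theorem HasSum.indicator_extract {ι : Type*} {A : Set ι} {f g : ι → Ser} {S : Ser} (i : Var)
    (k : ℕ) (key : ι → ℕ) (h : HasSum (A.indicator f) S)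
    (hfg : ∀ l ∈ A, extract i k (f l) = if key l = k then g l else 0) :
    HasSum ({l | l ∈ A ∧ key l = k}.indicator g) (extract i k S) := by
  convert HasSum.indicator_map (fun h => hasSum_extract h i k) (extract_zero i k) h hfg using 1
  ext1 l
  by_cases hl : l ∈ A <;> by_cases hk : key l = k <;> simp [hl, hk]

theorem HasSum.indicator_union {ι : Type*} {A B : Set ι} {f : ι → Ser} {S T : Ser}
    (hA : HasSum (A.indicator f) S) (hB : HasSum (B.indicator f) T) (hd : Disjoint A B) :
    HasSum ((A ∪ B).indicator f) (S + T) := by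
  rw [indicator_union_of_disjoint hd]
  exact hA.add hB

theorem HasSum.indicator_congr {ι : Type*} {A B : Set ι} {f g : ι → Ser} {S : Ser}
    (h : HasSum (A.indicator f) S) (hAB : A = B) (hfg : ∀ l ∈ B, f l = g l) :
    HasSum (B.indicator g) S := by
  subst hAB
  rwa [← Set.indicator_congr hfg]

theorem exists_hasSum_indicator {ι : Type*} {f : ι → Ser} {S : Ser} (h : HasSum f S) (A : Set ι) :
    ∃ T, HasSum (A.indicator f) T := by
  classical
  rw [PowerSeries.WithPiTopology.hasSum_iff_hasSum_coeff] at h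
  refine ⟨PowerSeries.mk fun n => ∑ᶠ l, PowerSeries.coeff n (A.indicator f l), ?_⟩
  rw [PowerSeries.WithPiTopology.hasSum_iff_hasSum_coeff]
  intro n
  rw [hasSum_discrete_iff, PowerSeries.coeff_mk]
  refine ⟨(hasSum_discrete_iff.1 (h n)).1.subset fun l hl => ?_, rfl⟩
  by_cases hA : l ∈ A
  · simpa [hA] using hl
  · simp [hA] at hl

/-- Grouping the terms by the value of `key` produces the quotient series `F i` directly as sums of
monomials, so no division by powers of `q` or `t` is needed. -/
theorem exists_hasFormalSum {ι : Type*} {B : Set ι} {f : ι → Ser} {S : Ser}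
    (h : HasSum (B.indicator f) S) (key : ι → ℕ) {s : Set ℕ} (hs : ∀ l ∈ B, key l ∈ s) :
    ∃ F : ℕ → Ser, (∀ i, HasSum ({l | l ∈ B ∧ key l = i}.indicator f) (F i)) ∧
      HasFormalSum s F S := by
  have hind : ∀ i, {l | key l = i}.indicator (B.indicator f) = {l | l ∈ B ∧ key l = i}.indicator f :=
    fun i => by
      rw [indicator_indicator]
      congr 1
      ext l
      exact and_comm
  choose F hF using fun i => exists_hasSum_indicator h {l | key l = i}
  refine ⟨F, fun i => hind i ▸ hF i, hasFormalSum_of_hasSum ?_⟩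
  have hF0 : s.indicator F = F := by
    rw [indicator_eq_self]
    intro i hi
    by_contra his
    refine hi ((hF i).unique ?_)
    convert hasSum_zero (α := Ser) with l
    by_cases hl : key l = i
    · have : l ∉ B := fun hB => his (hl ▸ hs l hB)
      simp [this]
    · simp [hl]
  rw [hF0]
  have h' := (Equiv.sigmaFiberEquiv key).hasSum_iff.2 h
  refine h'.sigma fun i => ?_
  exact (hasSum_subtype_iff_indicator (s := {l | key l = i})).2 (hF i)

theorem HasSum.indicator_prod {ι κ : Type*} {A : Set ι} {B : Set κ} {f : ι → Ser} {g : κ → Ser}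
    {S T : Ser} (hA : HasSum (A.indicator f) S) (hB : HasSum (B.indicator g) T) :
    HasSum ((A ×ˢ B).indicator fun p => f p.1 * g p.2) (S * T) := by
  have key : ((A ×ˢ B).indicator fun p => f p.1 * g p.2)
      = fun p => A.indicator f p.1 * B.indicator g p.2 := by
    ext1 p
    by_cases h1 : p.1 ∈ A <;> by_cases h2 : p.2 ∈ B <;> simp [h1, h2]
  rw [key]
  refine hA.mul hB ?_
  rw [PowerSeries.WithPiTopology.summable_iff_summable_coeff]
  intro n
  rw [PowerSeries.WithPiTopology.hasSum_iff_hasSum_coeff] at hA hB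
  -- A pair contributes to `q ^ n` only if, for some splitting of `n`, both factors have a nonzero
  -- coefficient. This leaves finitely many pairs.
  refine summable_of_hasFiniteSupport ((Set.Finite.biUnion (Finset.finite_toSet (Finset.HasAntidiagonal.antidiagonal n)) fun x _ =>
    (hasSum_discrete_iff.1 (hA x.1)).1.prod (hasSum_discrete_iff.1 (hB x.2)).1).subset ?_)
  intro p hp
  rw [Function.mem_support, PowerSeries.coeff_mul] at hp
  obtain ⟨x, hx, hne⟩ := Finset.exists_ne_zero_of_sum_ne_zero hp
  simp only [Set.mem_iUnion]
  exact ⟨x, hx, left_ne_zero_of_mul hne, right_ne_zero_of_mul hne⟩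

/-! ### The functional equation has at most one solution -/

/-- The substituted series in `substVQ`. -/
noncomputable def varVQ : Var → Ser
  | .x => var .x
  | .u => var .u
  | .v => var .v * q
  | .t => var .t

theorem substVQ_eq : substVQ = substitute varVQ 1 := by
  rw [substVQ]
  congr 1
-- Each monomial receives the factor `q` to the power of its exponent of `v`.
theorem coeff_aeval_varVQ (p : MvPolynomial Var ℤ) (m : ℕ) (d : Var →₀ ℕ) :
    (PowerSeries.coeff m (MvPolynomial.aeval varVQ p)).coeff d
      = if d .v = m then p.coeff d else 0 := by
  classical
  induction p using MvPolynomial.induction_on' with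
  | monomial e c =>
    have h : MvPolynomial.aeval varVQ (MvPolynomial.monomial e c)
        = PowerSeries.monomial (e .v) (MvPolynomial.monomial e c) := by
      have he : e = expo (e .x) (e .u) (e .v) (e .t) :=
        expo_ext (expo_x ..).symm (expo_u ..).symm (expo_v ..).symm (expo_t ..).symm
      have hc : (MvPolynomial.monomial e c : MvPolynomial Var ℤ) = c • MvPolynomial.monomial e 1 := by
        rw [MvPolynomial.smul_monomial, smul_eq_mul, mul_one]
      rw [hc, map_zsmul, map_zsmul]
      congr 1
      have := substVQ_mon 0 (e .x) (e .u) (e .v) (e .t)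
      rw [mon, mon, substVQ_eq, substitute_monomial _ le_rfl, ← he] at this
      simpa using this
    rw [h, PowerSeries.coeff_monomial]
    split_ifs with h1 h2 h2
    · rfl
    · rw [MvPolynomial.coeff_monomial, if_neg]
      rintro rfl
      exact h2 h1.symm
    · rw [MvPolynomial.coeff_monomial, if_neg]
      · simp
      · rintro rfl
        exact h1 h2.symm
    · simp
  | add p p' hp hp' =>
    rw [map_add, map_add, MvPolynomial.coeff_add, hp, hp']
    split_ifs <;> simp

theorem coeff_substVQ (F : Ser) (n : ℕ) (d : Var →₀ ℕ) :
    (PowerSeries.coeff n (substVQ F)).coeff d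
      = if d .v ≤ n then (PowerSeries.coeff (n - d .v) F).coeff d else 0 := by
  rw [substVQ_eq, substitute, PowerSeries.coeff_mk, MvPolynomial.coeff_sum]
  have key : ∀ m ∈ Finset.range (n + 1), (PowerSeries.coeff n (MvPolynomial.aeval varVQ
      (PowerSeries.coeff m F) * q ^ (1 * m))).coeff d
      = if m + d .v = n then (PowerSeries.coeff m F).coeff d else 0 := by
    intro m hm
    have hm : m ≤ n := by simpa [Nat.lt_succ_iff] using hm
    rw [q, PowerSeries.coeff_mul_X_pow', one_mul, if_pos hm, coeff_aeval_varVQ]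
    congr 1
    rw [eq_iff_iff]
    omega
  rw [Finset.sum_congr rfl key]
  split_ifs with h
  · rw [Finset.sum_eq_single (n - d .v)]
    · rw [if_pos (by omega)]
    · intro m _ hm
      rw [if_neg (by omega)]
    · intro hn
      simp at hn
  · exact Finset.sum_eq_zero fun m _ => if_neg (by omega)

theorem coeff_mon_mul (n a b c d : ℕ) (F : Ser) (m : ℕ) (e : Var →₀ ℕ) :
    (PowerSeries.coeff m (mon n a b c d * F)).coeff e
      = if n ≤ m ∧ expo a b c d ≤ e then (PowerSeries.coeff (m - n) F).coeff (e - expo a b c d)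
        else 0 := by
  have h : mon n a b c d = PowerSeries.X ^ n * PowerSeries.C (MvPolynomial.monomial (expo a b c d) 1) := by
    rw [mon, PowerSeries.X_pow_eq, ← PowerSeries.monomial_zero_eq_C_apply,
      PowerSeries.monomial_mul_monomial, add_zero, one_mul]
  rw [h, mul_assoc, PowerSeries.coeff_X_pow_mul']
  by_cases hn : n ≤ m
  · rw [if_pos hn, PowerSeries.coeff_C_mul, MvPolynomial.coeff_monomial_mul']
    by_cases he : expo a b c d ≤ e <;> simp [hn, he]
  · simp [hn]

/-- This is the homogeneous equation satisfied by the difference of two solutions. Strong induction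
on the power of `q` works because the coefficient of `q ^ (n + 1)`, at an exponent of `v` increased
by one, is the coefficient of `q ^ n` in `G` on the left and involves only smaller indices on the
right. -/
theorem eq_zero_of_functionalEquation {G : Ser}
    (h : mon 1 0 0 1 0 * G = mon 2 1 0 2 3 * substVQ G
      + mon 0 1 0 0 1 * (substVQ G - mon 0 0 0 1 0 * extract .v 1 (substVQ G))) : G = 0 := by
  ext1 n
  induction n using Nat.strong_induction_on with
  | _ n ih =>
  ext e
  have h1 := congrArg (fun f => (PowerSeries.coeff (n + 1) f).coeff (e + expo 0 0 1 0)) h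
  simp only [map_add, MvPolynomial.coeff_add] at h1
  rw [coeff_mon_mul, coeff_mon_mul, coeff_mon_mul, if_pos ⟨by omega, by simp⟩, add_tsub_cancel_right,
    add_tsub_cancel_right] at h1
  rw [h1, map_zero, MvPolynomial.coeff_zero]
  have z1 : ∀ e', 2 ≤ n + 1 → (PowerSeries.coeff (n + 1 - 2) (substVQ G)).coeff e' = 0 := by
    intro e' hn
    rw [coeff_substVQ, ih _ (by omega)]
    simp
  -- The exponent of `v` here is at least one. If it is one, the subtracted extraction cancels the
  -- term. Otherwise the substitution `v ↦ v q` consumes at least two powers of `q`, so the index in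
  -- `G` is below `n`.
  have z2 : ∀ e', e' .v = e .v + 1 → (PowerSeries.coeff (n + 1 - 0)
      (substVQ G - mon 0 0 0 1 0 * extract .v 1 (substVQ G))).coeff e' = 0 := by
    intro e' he'
    have hle : expo 0 0 1 0 ≤ e' := by
      intro i
      cases i
      · simp [expo_x]
      · simp [expo_u]
      · rw [expo_v]; omega
      · simp [expo_t]
    rw [map_sub, MvPolynomial.coeff_sub, coeff_mon_mul, if_pos ⟨by omega, hle⟩, coeff_extract]
    by_cases hv : e .v = 0
    · rw [if_pos (by rw [Finsupp.tsub_apply, expo_v]; omega)]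
      have : e' - expo 0 0 1 0 + Finsupp.single .v 1 = e' := by
        have h2 : expo 0 0 1 0 = Finsupp.single .v 1 := by simp [expo]
        rw [← h2, tsub_add_cancel_of_le hle]
      rw [this]
      exact sub_self _
    · rw [if_neg (by rw [Finsupp.tsub_apply, expo_v]; omega), sub_zero, coeff_substVQ]
      split_ifs
      · rw [ih _ (by omega)]
        simp
      · rfl
  have r1 : ∀ p : Prop, [Decidable p] → ∀ a : ℤ, (p → a = 0) → (if p then a else 0) = 0 := by
    intro p _ a ha
    split_ifs with hp
    · exact ha hp
    · rfl
  rw [r1 _ _ fun hp => z1 _ hp.1, r1 _ _ fun hp => z2 _ ?_, add_zero]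
  simp [expo_v]

theorem functionalEquation_unique {F F' : Ser} (h : FunctionalEquation F)
    (h' : FunctionalEquation F') : F = F' := by
  rw [← sub_eq_zero]
  apply eq_zero_of_functionalEquation
  have hs : substVQ (F - F') = substVQ F - substVQ F' := by
    rw [substVQ_eq]
    exact (substituteHom varVQ 1).map_sub F F'
  have he : extract .v 1 (substVQ F - substVQ F')
      = extract .v 1 (substVQ F) - extract .v 1 (substVQ F') := (extractHom .v 1).map_sub _ _
  rw [FunctionalEquation] at h h'
  rw [hs, he]
  simp only [mon_eq]
  linear_combination h - h'

/-! ### Lists of column sizes -/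

/-- The first size. -/
def first (l : List ℕ) : ℕ := l.headD 0

/-- The last size. -/
def last (l : List ℕ) : ℕ := first l.reverse

/-- The successive differences. -/
def diffs : List ℕ → List ℤ
  | a :: b :: l => ((b : ℤ) - a) :: diffs (b :: l)
  | _ => []

/-- The total decrease, a final decrease to zero included. -/
def totalDecrease : List ℕ → ℕ
  | [] => 0
  | n :: l => (n - first l) + totalDecrease l

/-- The half perimeter of the symmetric polyomino with the given column sizes. -/
def half (l : List ℕ) : ℕ := l.length + 2 * totalDecrease l

/-- A pair of differences that may occur in this order in a convex polyomino. -/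
def Unimodal (d d' : ℤ) : Prop := (d < 0 → d' ≤ 1) ∧ (d < -1 → d' < 0)

/-- The sequences of column sizes of symmetric column-convex polyominoes. -/
def sizes : Set (List ℕ) := {l | l ≠ [] ∧ (∀ n ∈ l, 0 < n) ∧ ∀ z ∈ diffs l, z % 2 = 1}

/-- The sequences of column sizes of symmetric convex polyominoes. -/
def convexSizes : Set (List ℕ) := {l | l ∈ sizes ∧ (diffs l).Pairwise Unimodal}

/-- The decreasing sequences. -/
def decSizes : Set (List ℕ) := {l | l ∈ sizes ∧ ∀ z ∈ diffs l, z < 0}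

/-- The oscillating sequences. -/
def oscSizes : Set (List ℕ) := {l | l ∈ sizes ∧ ∀ z ∈ diffs l, z = 1 ∨ z = -1}

/-- The convex sequences with a weak decrease and no strong one. -/
def weakSizes : Set (List ℕ) :=
  {l | l ∈ convexSizes ∧ (∃ z ∈ diffs l, z < 0) ∧ ∀ z ∈ diffs l, ¬z < -1}

@[simp] theorem first_nil : first [] = 0 := rfl
@[simp] theorem first_cons (a : ℕ) (l : List ℕ) : first (a :: l) = a := rfl
@[simp] theorem diffs_nil : diffs [] = [] := rfl
@[simp] theorem diffs_singleton (a : ℕ) : diffs [a] = [] := rfl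
@[simp] theorem diffs_cons_cons (a b : ℕ) (l : List ℕ) :
    diffs (a :: b :: l) = ((b : ℤ) - a) :: diffs (b :: l) := rfl
@[simp] theorem totalDecrease_nil : totalDecrease [] = 0 := rfl
@[simp] theorem totalDecrease_cons (a : ℕ) (l : List ℕ) :
    totalDecrease (a :: l) = (a - first l) + totalDecrease l := rfl

theorem first_append {l : List ℕ} (h : l ≠ []) (l' : List ℕ) : first (l ++ l') = first l := by
  cases l with
  | nil => exact absurd rfl h
  | cons a l => rfl

theorem last_append (l : List ℕ) {l' : List ℕ} (h : l' ≠ []) : last (l ++ l') = last l' := by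
  rw [last, List.reverse_append, first_append (by simpa using h), last]

@[simp] theorem last_singleton (a : ℕ) : last [a] = a := rfl

@[simp] theorem last_cons_cons (a b : ℕ) (l : List ℕ) : last (a :: b :: l) = last (b :: l) :=
  last_append [a] (by simp)

@[simp] theorem last_reverse (l : List ℕ) : last l.reverse = first l := by
  rw [last, List.reverse_reverse]

theorem first_reverse (l : List ℕ) : first l.reverse = last l := rfl

/-! ### Concatenation and reversal of sequences -/

theorem diffs_overlap (l : List ℕ) (a : ℕ) (r : List ℕ) :
    diffs (l ++ a :: r) = diffs (l ++ [a]) ++ diffs (a :: r) := by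
  induction l with
  | nil => simp
  | cons b l ih =>
    cases l with
    | nil => simp
    | cons c l => simpa using ih

theorem diffs_reverse (l : List ℕ) : diffs l.reverse = ((diffs l).map Neg.neg).reverse := by
  induction l with
  | nil => rfl
  | cons a l ih =>
    cases l with
    | nil => rfl
    | cons b l =>
      rw [List.reverse_cons, List.reverse_cons, List.append_assoc, List.singleton_append,
        diffs_overlap, ← List.reverse_cons, ih]
      simp

/-- A walk from zero through the sizes back to zero falls as much as it rises, so its total
variation is twice its total fall. The default `first [] = 0` supplies the last fall. This form
makes the invariance under reversal visible. -/
theorem two_mul_totalDecrease (l : List ℕ) : 2 * (totalDecrease l : ℤ)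
    = first l + last l + ((diffs l).map fun z => |z|).sum := by
  induction l with
  | nil => rfl
  | cons a l ih =>
    cases l with
    | nil => simp; ring
    | cons b l =>
      rw [totalDecrease_cons, Nat.cast_add, mul_add, ih]
      simp only [first_cons, last_cons_cons, diffs_cons_cons, List.map_cons, List.sum_cons]
      rcases le_total a b with h | h
      · rw [abs_of_nonneg (by omega)]
        omega
      · rw [abs_of_nonpos (by omega)]
        omega

theorem totalDecrease_reverse (l : List ℕ) : totalDecrease l.reverse = totalDecrease l := by
  have h1 := two_mul_totalDecrease l
  have h2 := two_mul_totalDecrease l.reverse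
  rw [first_reverse, last_reverse, diffs_reverse, List.map_reverse, List.sum_reverse,
    List.map_map] at h2
  have : ((fun z : ℤ => |z|) ∘ Neg.neg) = fun z => |z| := by
    ext z
    exact abs_neg z
  rw [this] at h2
  omega

theorem half_reverse (l : List ℕ) : half l.reverse = half l := by
  rw [half, half, totalDecrease_reverse, List.length_reverse]

/-- Cutting at `a` adds a fall from `a` to zero at the end of the left piece; hence the correction
`a`. -/
theorem totalDecrease_append (l : List ℕ) (a : ℕ) (r : List ℕ) :
    totalDecrease (l ++ a :: r) + a = totalDecrease (l ++ [a]) + totalDecrease (a :: r) := by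
  induction l with
  | nil => simp; ring
  | cons b l ih =>
    rw [List.cons_append, List.cons_append, totalDecrease_cons, totalDecrease_cons b]
    have : first (l ++ a :: r) = first (l ++ [a]) := by cases l <;> rfl
    rw [this]
    omega

theorem totalDecrease_of_dec {l : List ℕ} (h : ∀ z ∈ diffs l, z < 0) :
    totalDecrease l = first l := by
  induction l with
  | nil => rfl
  | cons a l ih =>
    cases l with
    | nil => simp
    | cons b l =>
      simp only [diffs_cons_cons, List.forall_mem_cons] at h
      rw [totalDecrease_cons, ih h.2, first_cons, first_cons]
      omega

theorem sizes_reverse {l : List ℕ} : l.reverse ∈ sizes ↔ l ∈ sizes := by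
  simp only [sizes, mem_ofPred_eq, diffs_reverse]
  simp only [ne_eq, List.reverse_eq_nil_iff, List.mem_reverse, List.mem_map,
    forall_exists_index, and_imp, forall_apply_eq_imp_iff₂]
  refine and_congr_right fun _ => and_congr_right fun _ => forall₂_congr fun z _ => ?_
  omega

theorem oscSizes_reverse {l : List ℕ} : l.reverse ∈ oscSizes ↔ l ∈ oscSizes := by
  simp only [oscSizes, mem_ofPred_eq, diffs_reverse, sizes_reverse]
  simp only [List.mem_reverse, List.mem_map, forall_exists_index, and_imp,
    forall_apply_eq_imp_iff₂]
  refine and_congr_right fun _ => forall₂_congr fun z _ => ?_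
  omega

theorem mem_sizes_cons_cons {a b : ℕ} {l : List ℕ} :
    a :: b :: l ∈ sizes ↔ 0 < a ∧ (a + b) % 2 = 1 ∧ b :: l ∈ sizes := by
  simp only [sizes, mem_ofPred_eq, diffs_cons_cons, List.forall_mem_cons]
  have : ((b : ℤ) - a) % 2 = 1 ↔ (a + b) % 2 = 1 := by omega
  rw [this]
  simp
  tauto

theorem singleton_mem_sizes {a : ℕ} : [a] ∈ sizes ↔ 0 < a := by simp [sizes]

theorem mem_decSizes_cons_cons {a b : ℕ} {l : List ℕ} :
    a :: b :: l ∈ decSizes ↔ b < a ∧ (a + b) % 2 = 1 ∧ b :: l ∈ decSizes := by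
  simp only [decSizes, mem_ofPred_eq, diffs_cons_cons, List.forall_mem_cons, mem_sizes_cons_cons]
  have : ((b : ℤ) - a) < 0 ↔ b < a := by omega
  rw [this]
  constructor
  · tauto
  · rintro ⟨h1, h2, h3, h4⟩
    exact ⟨⟨by omega, h2, h3⟩, h1, h4⟩

theorem mem_oscSizes_cons_cons {a b : ℕ} {l : List ℕ} : a :: b :: l ∈ oscSizes ↔
    0 < a ∧ (a = b + 1 ∨ b = a + 1) ∧ b :: l ∈ oscSizes := by
  simp only [oscSizes, mem_ofPred_eq, diffs_cons_cons, List.forall_mem_cons, mem_sizes_cons_cons]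
  have : ((b : ℤ) - a = 1 ∨ (b : ℤ) - a = -1) ↔ (a = b + 1 ∨ b = a + 1) := by omega
  rw [this]
  constructor
  · tauto
  · rintro ⟨h1, h2, h3, h4⟩
    exact ⟨⟨h1, by omega, h3⟩, h2, h4⟩

theorem pos_of_mem_sizes {a : ℕ} {l : List ℕ} (h : a :: l ∈ sizes) : 0 < a :=
  h.2.1 a (by simp)

theorem finite_sizes (n : ℕ) : {l : List ℕ | l ∈ sizes ∧ l.sum = n}.Finite := by
  refine (Set.finite_range (fun c : Composition n => c.blocks)).subset ?_
  rintro l ⟨hl, hn⟩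
  exact ⟨⟨l, fun {i} hi => hl.2.1 i hi, hn⟩, rfl⟩

theorem finite_subset_sizes {A : Set (List ℕ)} (h : A ⊆ sizes) (n : ℕ) :
    {l : List ℕ | l ∈ A ∧ l.sum = n}.Finite :=
  (finite_sizes n).subset fun _ hl => ⟨h hl.1, hl.2⟩

theorem decSizes_subset : decSizes ⊆ convexSizes := by
  rintro l ⟨hl, h⟩
  refine ⟨hl, List.pairwise_of_forall_mem_list ?_⟩
  intro d hd d' hd'
  have := h d' hd'
  exact ⟨fun _ => by omega, fun _ => this⟩

theorem oscSizes_subset : oscSizes ⊆ convexSizes := by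
  rintro l ⟨hl, h⟩
  refine ⟨hl, List.pairwise_of_forall_mem_list ?_⟩
  intro d hd d' hd'
  have h1 := h d hd
  have h2 := h d' hd'
  exact ⟨fun _ => by omega, fun _ => by omega⟩

theorem convexSizes_reverse {l : List ℕ} : l.reverse ∈ convexSizes ↔ l ∈ convexSizes := by
  simp only [convexSizes, mem_ofPred_eq, sizes_reverse]
  refine and_congr_right fun hl => ?_
  rw [diffs_reverse, List.pairwise_reverse, List.pairwise_map]
  have hodd := hl.2.2
  constructor <;> intro h
  all_goals
    refine h.imp_of_mem fun {d d'} hd hd' h' => ?_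
    have h1 := hodd d hd
    have h2 := hodd d' hd'
    simp only [Unimodal] at h' ⊢
    omega

theorem not_mem_decSizes_of_reverse_mem {m : List ℕ} (h : m.reverse ∈ weakSizes) : m ∉ decSizes := by
  intro hm
  obtain ⟨z, hz, hz0⟩ := h.2.1
  rw [diffs_reverse, List.mem_reverse, List.mem_map] at hz
  obtain ⟨y, hy, rfl⟩ := hz
  have := hm.2 y hy
  omega

/-- The right side is state 0. Differences are odd, so those that are not negative are positive, and
they become decreases when read backwards. -/
theorem mem_decSizes_reverse {l : List ℕ} :
    l.reverse ∈ decSizes ↔ l ∈ convexSizes ∧ ∀ z ∈ diffs l, ¬z < 0 := by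
  constructor
  · intro h
    refine ⟨convexSizes_reverse.1 (decSizes_subset h), fun z hz hz0 => ?_⟩
    have := h.2 (-z) (by rw [diffs_reverse]; simpa using hz)
    omega
  · rintro ⟨h1, h2⟩
    refine ⟨(convexSizes_reverse.2 h1).1, fun z hz => ?_⟩
    rw [diffs_reverse, List.mem_reverse, List.mem_map] at hz
    obtain ⟨y, hy, rfl⟩ := hz
    have := h2 y hy
    have := h1.1.2.2 y hy
    omega

/-! ### Splitting at the first decrease -/

/-- A decreasing sequence, to be reversed, and an oscillating one, which it precedes. -/
def splitPairs : Set (List ℕ × List ℕ) :=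
  {p | p.1 ∈ decSizes ∧ p.2 ∈ oscSizes ∧ first p.1 = first p.2 + 1}

theorem diffs_reverse_append {i j : ℕ} {r s : List ℕ} :
    diffs ((i :: r).reverse ++ j :: s)
      = diffs (i :: r).reverse ++ ((j : ℤ) - i) :: diffs (j :: s) := by
  rw [List.reverse_cons, List.append_assoc, List.singleton_append, diffs_overlap, diffs_cons_cons]

theorem diffs_reverse_pos {m : List ℕ} (hm : m ∈ decSizes) : ∀ z ∈ diffs m.reverse, 0 < z := by
  intro z hz
  rw [diffs_reverse, List.mem_reverse, List.mem_map] at hz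
  obtain ⟨y, hy, rfl⟩ := hz
  have := hm.2 y hy
  omega

theorem append_mem_weakSizes {p : List ℕ × List ℕ} (hp : p ∈ splitPairs) :
    p.1.reverse ++ p.2 ∈ weakSizes := by
  obtain ⟨m, l⟩ := p
  obtain ⟨hm, hl, hml⟩ := hp
  dsimp only at hm hl hml ⊢
  cases m with
  | nil => exact absurd rfl hm.1.1
  | cons i r =>
  cases l with
  | nil => exact absurd rfl hl.1.1
  | cons j s =>
  have hpos := diffs_reverse_pos hm
  have hodd := (sizes_reverse.2 hm.1).2.2
  have hij : (j : ℤ) - i = -1 := by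
    simp only [first_cons] at hml
    omega
  have hd : diffs ((i :: r).reverse ++ j :: s) = diffs (i :: r).reverse ++ -1 :: diffs (j :: s) := by
    rw [diffs_reverse_append, hij]
  refine ⟨⟨⟨by simp, ?_, ?_⟩, ?_⟩, ⟨-1, by rw [hd]; simp, by norm_num⟩, ?_⟩
  · intro n hn
    rw [List.mem_append, List.mem_reverse] at hn
    exact hn.elim (hm.1.2.1 n) (hl.1.2.1 n)
  · intro z hz
    rw [hd, List.mem_append, List.mem_cons] at hz
    rcases hz with hz | rfl | hz
    · exact hodd z hz
    · rfl
    · exact hl.1.2.2 z hz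
  · rw [hd, List.pairwise_append, List.pairwise_cons]
    refine ⟨?_, ⟨fun z hz => ?_, ?_⟩, fun z hz z' _ => ?_⟩
    · refine List.pairwise_of_forall_mem_list fun z hz _ _ => ?_
      have := hpos z hz
      exact ⟨fun _ => by omega, fun _ => by omega⟩
    · have := hl.2 z hz
      exact ⟨fun _ => by omega, fun _ => by omega⟩
    · exact (oscSizes_subset hl).2
    · have := hpos z hz
      exact ⟨fun _ => by omega, fun _ => by omega⟩
  · intro z hz
    rw [hd, List.mem_append, List.mem_cons] at hz
    rcases hz with hz | rfl | hz
    · have := hpos z hz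
      omega
    · norm_num
    · have := hl.2 z hz
      omega

/-- The cut is made at the first decrease. Before it all differences are positive. After it
convexity excludes strong growths and the hypothesis excludes strong decreases, so the rest
oscillates. -/
theorem exists_split {l : List ℕ} (hl : l ∈ weakSizes) :
    ∃ p ∈ splitPairs, p.1.reverse ++ p.2 = l := by
  induction l with
  | nil => exact absurd rfl hl.1.1.1
  | cons a l ih =>
  cases l with
  | nil =>
    obtain ⟨z, hz, -⟩ := hl.2.1
    simp at hz
  | cons b l =>
  obtain ⟨⟨hs, hu⟩, hneg, hweak⟩ := hl
  simp only [diffs_cons_cons, List.pairwise_cons, List.forall_mem_cons] at hu hneg hweak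
  obtain ⟨ha, hab, hs'⟩ := mem_sizes_cons_cons.1 hs
  by_cases hlt : b < a
  · refine ⟨([a], b :: l), ⟨⟨singleton_mem_sizes.2 ha, by simp⟩, ⟨hs', fun z hz => ?_⟩, ?_⟩, rfl⟩
    · have h1 := (hu.1 z hz).1 (by omega)
      have h2 := hweak.2 z hz
      have h3 := hs'.2.2 z hz
      omega
    · simp only [first_cons]
      omega
  · have hex : ∃ z ∈ diffs (b :: l), z < 0 := by
      obtain ⟨z, hz, hz0⟩ := hneg
      rcases List.mem_cons.1 hz with rfl | hz
      · omega
      · exact ⟨z, hz, hz0⟩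
    obtain ⟨⟨m, s⟩, ⟨hm, hs2, hms⟩, heq⟩ := ih ⟨⟨hs', hu.2⟩, hex, hweak.2⟩
    dsimp only at hm hs2 hms heq
    have hmne : m ≠ [] := hm.1.1
    refine ⟨(m ++ [a], s), ⟨?_, hs2, ?_⟩, by simp [heq]⟩
    · have hrev : ∃ r, m.reverse = b :: r := by
        cases hmr : m.reverse with
        | nil => exact absurd (List.reverse_eq_nil_iff.1 hmr) hmne
        | cons c r =>
          rw [hmr, List.cons_append, List.cons.injEq] at heq
          exact ⟨r, by rw [heq.1]⟩
      obtain ⟨r, hr⟩ := hrev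
      have hconv := mem_decSizes_reverse.1 (show m.reverse.reverse ∈ decSizes by simpa using hm)
      have : (m ++ [a]) = (a :: m.reverse).reverse := by simp
      rw [this, mem_decSizes_reverse]
      have hd : ∀ z ∈ diffs (a :: m.reverse), ¬z < 0 := by
        rw [hr, diffs_cons_cons, List.forall_mem_cons, ← hr]
        exact ⟨by omega, hconv.2⟩
      refine ⟨⟨?_, ?_⟩, hd⟩
      · rw [hr, mem_sizes_cons_cons, ← hr]
        exact ⟨ha, hab, hconv.1.1⟩
      · refine List.pairwise_of_forall_mem_list fun z hz _ _ => ?_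
        have := hd z hz
        exact ⟨fun _ => by omega, fun _ => by omega⟩
    · dsimp only
      rw [first_append hmne, hms]

/-- If the second cut were later, the decrease at the first cut would lie inside the increasing part
of the second splitting. -/
theorem split_le {m m' l l' c : List ℕ} (h : (m, l) ∈ splitPairs) (h' : (m', l') ∈ splitPairs)
    (hm : m'.reverse = m.reverse ++ c) (hl : l = c ++ l') : c = [] := by
  cases c with
  | nil => rfl
  | cons j c =>
    exfalso
    obtain ⟨hm1, hl1, hml⟩ := h
    dsimp only at hm1 hl1 hml
    rw [hl] at hml
    cases m with
    | nil => exact absurd rfl hm1.1.1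
    | cons i r =>
      have h2 := diffs_reverse_pos h'.1 ((j : ℤ) - i) (by
        dsimp only
        rw [hm, diffs_reverse_append]
        simp)
      simp only [List.cons_append, first_cons] at hml
      omega

theorem bijOn_split : BijOn (fun p : List ℕ × List ℕ => p.1.reverse ++ p.2) splitPairs weakSizes := by
  refine ⟨fun p hp => append_mem_weakSizes hp, ?_, fun l hl => exists_split hl⟩
  rintro ⟨m, l⟩ h ⟨m', l'⟩ h' heq
  dsimp only at heq
  rcases List.append_eq_append_iff.1 heq with ⟨c, hc1, hc2⟩ | ⟨c, hc1, hc2⟩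
  · obtain rfl := split_le h h' hc1 hc2
    simp only [List.append_nil, List.reverse_inj, List.nil_append] at hc1 hc2
    rw [hc1, hc2]
  · obtain rfl := split_le h' h hc1 hc2
    simp only [List.append_nil, List.reverse_inj, List.nil_append] at hc1 hc2
    rw [hc1, hc2]

/-- With peak `i`, the separated increasing part falls from `i` to zero at its end, whereas the
joined list only falls by one there. The difference `i - 1` counts twice in the half perimeter. -/
theorem half_split {p : List ℕ × List ℕ} (hp : p ∈ splitPairs) :
    half (p.1.reverse ++ p.2) + (2 * first p.1 - 2) = half p.1 + half p.2 := by
  obtain ⟨m, l⟩ := p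
  obtain ⟨hm, hl, hml⟩ := hp
  dsimp only at hm hl hml ⊢
  cases m with
  | nil => exact absurd rfl hm.1.1
  | cons i r =>
  cases l with
  | nil => exact absurd rfl hl.1.1
  | cons j s =>
  have h1 := totalDecrease_append r.reverse i (j :: s)
  have h2 := totalDecrease_reverse (i :: r)
  rw [List.reverse_cons] at h2
  rw [totalDecrease_cons i] at h1
  simp only [first_cons] at hml h1 ⊢
  simp only [half, List.reverse_cons, List.append_assoc, List.singleton_append, List.length_append,
    List.length_reverse, List.length_cons]
  omega

/-! ### Palindromes -/

/-- The convex palindromic sequences. -/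
def palindromes : Set (List ℕ) := {l | l ∈ convexSizes ∧ l.reverse = l}

/-- The reversed left halves of the convex palindromic sequences. -/
def halves : Set (List ℕ) := {m | m ∈ convexSizes ∧ ∀ z ∈ diffs m, ¬1 < z}

/-- The reverse of `m` is a left half, which has no strong decrease: it is in state 0 if `m` only
decreases, and in state 1 otherwise. -/
theorem halves_eq : halves = decSizes ∪ {m | m.reverse ∈ weakSizes} := by
  ext m
  have key : ∀ p : ℤ → Prop, (∀ z ∈ diffs m.reverse, p z) ↔ ∀ z ∈ diffs m, p (-z) := by
    intro p
    rw [diffs_reverse]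
    simp only [List.mem_reverse, List.mem_map, forall_exists_index, and_imp,
      forall_apply_eq_imp_iff₂]
  have hneg : (∃ z ∈ diffs m.reverse, z < 0) ↔ ¬∀ z ∈ diffs m, z ≤ 0 := by
    have := key fun z => ¬z < 0
    push Not at this ⊢
    rw [← not_iff_not]
    push Not
    rw [this]
    exact forall₂_congr fun z _ => by omega
  simp only [halves, weakSizes, mem_union, mem_ofPred_eq, convexSizes_reverse, hneg, key]
  constructor
  · rintro ⟨h1, h2⟩
    by_cases h : ∀ z ∈ diffs m, z ≤ 0
    · left
      refine ⟨h1.1, fun z hz => ?_⟩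
      have := h z hz
      have := h1.1.2.2 z hz
      omega
    · exact Or.inr ⟨h1, h, fun z hz => by have := h2 z hz; omega⟩
  · rintro (h | ⟨h1, h2, h3⟩)
    · exact ⟨decSizes_subset h, fun z hz => by have := h.2 z hz; omega⟩
    · exact ⟨h1, fun z hz => by have := h3 z hz; omega⟩

theorem exists_of_palindrome {l : List ℕ} (h : l.Palindrome) :
    (∃ i r, l = r.reverse ++ i :: r) ∨ ∃ r, l = r.reverse ++ r := by
  induction h with
  | nil => exact Or.inr ⟨[], rfl⟩
  | singleton a => exact Or.inl ⟨a, [], rfl⟩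
  | cons_concat x _ ih =>
    rcases ih with ⟨i, r, rfl⟩ | ⟨r, rfl⟩
    · exact Or.inl ⟨i, r ++ [x], by simp⟩
    · exact Or.inr ⟨r ++ [x], by simp⟩

theorem diffs_palindrome (i : ℕ) (r : List ℕ) : diffs (r.reverse ++ i :: r)
    = ((diffs (i :: r)).map Neg.neg).reverse ++ diffs (i :: r) := by
  rw [diffs_overlap, ← List.reverse_cons, diffs_reverse]

/-- Each difference `z` of the right half is preceded by its mirror image `-z`. A strong growth
would therefore follow a strong decrease, and without strong growths no pair across the centre
violates `Unimodal`. -/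
theorem palindrome_mem_convexSizes {i : ℕ} {r : List ℕ} :
    r.reverse ++ i :: r ∈ convexSizes ↔ i :: r ∈ halves := by
  have hs : r.reverse ++ i :: r ∈ sizes ↔ i :: r ∈ sizes := by
    simp only [sizes, mem_ofPred_eq, diffs_palindrome]
    constructor
    · rintro ⟨-, h1, h2⟩
      exact ⟨by simp, fun n hn => h1 n (List.mem_append_right _ hn),
        fun z hz => h2 z (List.mem_append_right _ hz)⟩
    · rintro ⟨-, h1, h2⟩
      refine ⟨by simp, fun n hn => ?_, fun z hz => ?_⟩
      · refine h1 n ?_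
        simp only [List.mem_append, List.mem_reverse, List.mem_cons] at hn ⊢
        tauto
      · rw [List.mem_append, List.mem_reverse, List.mem_map] at hz
        rcases hz with ⟨y, hy, rfl⟩ | hz
        · have := h2 y hy
          omega
        · exact h2 z hz
  have hr := convexSizes_reverse (l := i :: r)
  constructor
  · rintro ⟨h1, h2⟩
    rw [diffs_palindrome, List.pairwise_append] at h2
    refine ⟨⟨hs.1 h1, h2.2.1⟩, fun z hz hz1 => ?_⟩
    have := (h2.2.2 (-z) (by simpa using hz) z hz).2 (by omega)
    omega
  · rintro ⟨h1, h2⟩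
    refine ⟨hs.2 h1.1, ?_⟩
    rw [diffs_palindrome, List.pairwise_append]
    refine ⟨?_, h1.2, fun z hz z' hz' => ?_⟩
    · rw [← diffs_reverse]
      exact (hr.2 h1).2
    · rw [List.mem_reverse, List.mem_map] at hz
      obtain ⟨y, hy, rfl⟩ := hz
      have := h2 y hy
      have := h2 z' hz'
      exact ⟨fun _ => by omega, fun _ => by omega⟩

theorem bijOn_palindromes : BijOn (fun m : List ℕ => m.reverse ++ m.tail) halves palindromes := by
  have key : ∀ i r, (fun m : List ℕ => m.reverse ++ m.tail) (i :: r) = r.reverse ++ i :: r := by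
    intro i r
    simp
  refine ⟨fun m hm => ?_, ?_, ?_⟩
  · cases m with
    | nil => exact absurd rfl hm.1.1.1
    | cons i r =>
      rw [key]
      exact ⟨palindrome_mem_convexSizes.2 hm, by simp⟩
  · intro m hm m' hm' h
    have hlen := congrArg List.length h
    simp only [List.length_append, List.length_reverse, List.length_tail] at hlen
    have hl : m.length = m'.length := by omega
    exact List.reverse_inj.1 (List.append_inj h (by simpa using hl)).1
  · rintro l ⟨hl, hrev⟩
    rcases exists_of_palindrome (List.Palindrome.of_reverse_eq hrev) with ⟨i, r, rfl⟩ | ⟨r, rfl⟩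
    · exact ⟨i :: r, palindrome_mem_convexSizes.1 hl, key i r⟩
    · cases r with
      | nil => exact absurd rfl hl.1.1
      | cons i r =>
        -- A palindrome of even length has two equal middle columns, and their difference zero is
        -- not odd.
        have := hl.1.2.2 ((i : ℤ) - i) (by rw [diffs_reverse_append]; simp)
        simp at this

theorem sum_palindrome {m : List ℕ} (hm : m ≠ []) :
    (m.reverse ++ m.tail).sum + first m = 2 * m.sum := by
  cases m with
  | nil => exact absurd rfl hm
  | cons i r =>
    simp
    ring

/-- The two halves share the central column, which is counted once too often in the length, and its
size once too often in the total decrease. -/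
theorem half_palindrome {m : List ℕ} (hm : m ≠ []) :
    half (m.reverse ++ m.tail) + (2 * first m + 1) = 2 * half m := by
  cases m with
  | nil => exact absurd rfl hm
  | cons i r =>
    have h1 := totalDecrease_append r.reverse i r
    have h2 := totalDecrease_reverse (i :: r)
    rw [List.reverse_cons] at h2
    simp only [half, List.reverse_cons, List.append_assoc, List.singleton_append,
      List.length_append, List.length_reverse, List.length_cons, first_cons, List.tail_cons]
    omega

/-! ### Decreasing sequences and the polynomials `TS0` -/

/-- The possibly empty decreasing sequences which may follow a column of size `n + 1`. -/
def decTails (n : ℕ) : Set (List ℕ) := {l | (n + 1) :: l ∈ decSizes}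

/-- A column of size `n + 3` is followed by one of size `n + 2` or, by parity, by one of size at
most `n`. In the latter case, as when nothing follows, the tail could equally follow a column of
size `n + 1`. -/
theorem decTails_succ_succ (n : ℕ) :
    decTails (n + 2) = ((fun l => (n + 2) :: l) '' decTails (n + 1)) ∪ decTails n := by
  ext l
  simp only [decTails, mem_union, mem_image, mem_ofPred_eq]
  cases l with
  | nil => simp [decSizes, sizes]
  | cons a l =>
    simp only [mem_decSizes_cons_cons, List.cons.injEq]
    constructor
    · rintro ⟨h1, h2, h3⟩
      by_cases h : a = n + 2
      · subst h
        exact Or.inl ⟨l, h3, rfl, rfl⟩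
      · exact Or.inr ⟨by omega, by omega, h3⟩
    · rintro (⟨l', h, rfl, rfl⟩ | ⟨h1, h2, h3⟩)
      · exact ⟨by omega, by omega, h⟩
      · exact ⟨by omega, by omega, h3⟩

theorem decTails_zero : decTails 0 = {[]} := by
  ext l
  cases l with
  | nil => simp [decTails, decSizes, sizes]
  | cons a l =>
    simp only [decTails, mem_ofPred_eq, mem_decSizes_cons_cons, mem_singleton_iff]
    constructor
    · rintro ⟨h1, -, h3⟩
      have := pos_of_mem_sizes h3.1
      omega
    · simp

theorem decTails_one : decTails 1 = {[1]} ∪ {[]} := by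
  ext l
  cases l with
  | nil => simp [decTails, decSizes, sizes]
  | cons a l =>
    have h0 : l ∈ decTails 0 ↔ l = [] := by rw [decTails_zero, mem_singleton_iff]
    simp only [decTails, mem_ofPred_eq, zero_add] at h0
    simp only [decTails, mem_ofPred_eq, mem_decSizes_cons_cons, mem_union, mem_singleton_iff,
      List.cons.injEq, reduceCtorEq, or_false]
    constructor
    · rintro ⟨h1, h2, h3⟩
      have := pos_of_mem_sizes h3.1
      obtain rfl : a = 1 := by omega
      exact ⟨rfl, h0.1 h3⟩
    · rintro ⟨rfl, rfl⟩
      simp [decSizes, sizes]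

theorem hasSum_singleton_indicator {ι : Type*} (i : ι) (f : ι → Ser) :
    HasSum (({i} : Set ι).indicator f) (f i) := by
  convert hasSum_single i (f := ({i} : Set ι).indicator f) ?_ using 1
  · simp
  · intro j hj
    simp [hj]

theorem hasSum_TS0 (n : ℕ) :
    HasSum ((decTails n).indicator fun l => mon l.sum l.length 0 0 0) (TS0 n) := by
  induction n using Nat.twoStepInduction with
  | zero =>
    rw [decTails_zero]
    convert hasSum_singleton_indicator _ _ using 1
    simp [TS0, mon_zero]
  | one =>
    rw [decTails_one]
    have h1 := hasSum_singleton_indicator [1] (fun l => mon l.sum l.length 0 0 0)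
    have h2 := hasSum_singleton_indicator [] (fun l => mon l.sum l.length 0 0 0)
    convert HasSum.indicator_union h1 h2 (by simp) using 1
    simp [TS0, mon_zero, var_x, q_eq, mon_mul]
  | more n h1 h2 =>
    rw [decTails_succ_succ]
    have h3 : HasSum ((decTails (n + 1)).indicator fun l => mon ((n + 2) :: l).sum
        ((n + 2) :: l).length 0 0 0) (var .x * q ^ (n + 2) * TS0 (n + 1)) := by
      refine HasSum.indicator_mul_left _ h2 fun l _ => ?_
      simp only [var_x, q_eq, mon_pow, mon_mul, List.sum_cons, List.length_cons]
      congr 1 <;> ring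
    rw [hasSum_bijOn (InjOn.bijOn_image (f := fun l => (n + 2) :: l) (fun a _ b _ h =>
      (List.cons.inj h).2)) (g := fun l => mon l.sum l.length 0 0 0) (fun _ _ => rfl)] at h3
    refine HasSum.indicator_union h3 h1 ?_
    rw [Set.disjoint_left]
    rintro _ ⟨l, -, rfl⟩ h
    have := (mem_decSizes_cons_cons.1 h).1
    omega

theorem hasSum_decSizes_first {k : ℕ} (hk : 1 ≤ k) :
    HasSum ({l | l ∈ decSizes ∧ first l = k}.indicator fun l => mon l.sum l.length 0 0 0)
      (var .x * q ^ k * TS0 (k - 1)) := by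
  have hb : BijOn (fun l => k :: l) (decTails (k - 1)) {l | l ∈ decSizes ∧ first l = k} := by
    refine ⟨fun l hl => ?_, fun a _ b _ h => (List.cons.inj h).2, ?_⟩
    · rw [decTails, mem_ofPred_eq, Nat.sub_add_cancel hk] at hl
      exact ⟨hl, rfl⟩
    · rintro l ⟨hl, hlk⟩
      cases l with
      | nil => exact absurd rfl hl.1.1
      | cons a l =>
        obtain rfl : a = k := hlk
        refine ⟨l, ?_, rfl⟩
        rwa [decTails, mem_ofPred_eq, Nat.sub_add_cancel hk]
  rw [← hasSum_bijOn hb (f := fun l => mon (k :: l).sum (k :: l).length 0 0 0) (fun _ _ => rfl)]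
  refine HasSum.indicator_mul_left _ (hasSum_TS0 (k - 1)) fun l _ => ?_
  simp only [var_x, q_eq, mon_pow, mon_mul, List.sum_cons, List.length_cons]
  congr 1 <;> ring

theorem extract_stacks {T : Ser}
    (hT : HasSum (decSizes.indicator fun l => mon l.sum l.length (first l) 0 0) T) (k : ℕ) :
    HasSum ({l | l ∈ decSizes ∧ first l = k}.indicator fun l => mon l.sum l.length 0 0 0)
      (extract .u k T) :=
  HasSum.indicator_extract .u k first hT fun _ _ => extract_u_mon ..

theorem extract_first {A : Set (List ℕ)} {S : Ser}
    (hS : HasSum (A.indicator fun l => mon l.sum l.length 0 (first l) (half l)) S) (k : ℕ) :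
    HasSum ({l | l ∈ A ∧ first l = k}.indicator fun l => mon l.sum l.length 0 0 (half l))
      (extract .v k S) :=
  HasSum.indicator_extract .v k first hS fun _ _ => extract_v_mon ..

theorem half_of_mem_decSizes {l : List ℕ} (h : l ∈ decSizes) : half l = l.length + 2 * first l := by
  rw [half, totalDecrease_of_dec h.2]

/-- The half perimeter of a decreasing list is its length plus twice its first size. The first
summand is the substitution `x ↦ x t`, the second the factor `t ^ (2 * k)`. -/
theorem extract_eq_substXT {S T : Ser}
    (hS : HasSum (decSizes.indicator fun l => mon l.sum l.length 0 (first l) (half l)) S)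
    (hT : HasSum (decSizes.indicator fun l => mon l.sum l.length (first l) 0 0) T) (k : ℕ) :
    extract .v k S = var .t ^ (2 * k) * substXT (extract .u k T) := by
  refine (extract_first hS k).unique ?_
  refine HasSum.indicator_mul_left _ (HasSum.indicator_substitute _ 1 (extract_stacks hT k)
    fun l _ => substXT_mon ..) ?_
  rintro l ⟨hl, rfl⟩
  rw [var_t, mon_pow, mon_mul, half_of_mem_decSizes hl]
  congr 1 <;> ring

/-! ### Oscillating sequences -/

/-- The classification is by the removal of the first column. A smaller column can be added in front
only of a list whose first size is not one. -/
theorem oscSizes_eq : oscSizes = (fun n : ℕ => [n + 1]) '' univ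
    ∪ ((fun l => (first l + 1) :: l) '' oscSizes)
    ∪ ((fun l => (first l - 1) :: l) '' {l | l ∈ oscSizes ∧ ¬first l = 1}) := by
  ext l
  simp only [mem_union, mem_image, mem_univ, true_and, mem_ofPred_eq]
  cases l with
  | nil => simp [oscSizes, sizes]
  | cons a l =>
  cases l with
  | nil =>
    constructor
    · intro h
      have := pos_of_mem_sizes h.1
      exact Or.inl (Or.inl ⟨a - 1, by congr 1; omega⟩)
    · rintro ((⟨n, hn⟩ | ⟨l, hl, hn⟩) | ⟨l, hl, hn⟩)
      · rw [← hn]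
        simp [oscSizes, sizes]
      · rw [List.cons.injEq] at hn
        exact absurd hn.2 hl.1.1
      · rw [List.cons.injEq] at hn
        exact absurd hn.2 hl.1.1.1
  | cons b l =>
    rw [mem_oscSizes_cons_cons]
    constructor
    · rintro ⟨h1, rfl | rfl, h3⟩
      · exact Or.inl (Or.inr ⟨b :: l, h3, rfl⟩)
      · exact Or.inr ⟨(a + 1) :: l, ⟨h3, by simp only [first_cons]; omega⟩, rfl⟩
    · rintro ((⟨n, hn⟩ | ⟨l, hl, hn⟩) | ⟨l, hl, hn⟩)
      · simp at hn
      · rw [List.cons.injEq] at hn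
        obtain ⟨rfl, rfl⟩ := hn
        exact ⟨by omega, Or.inl rfl, hl⟩
      · rw [List.cons.injEq] at hn
        obtain ⟨rfl, rfl⟩ := hn
        have := pos_of_mem_sizes hl.1.1
        have := hl.2
        simp only [first_cons] at this ⊢
        exact ⟨by omega, Or.inr (by omega), hl.1⟩

theorem half_cons_succ {l : List ℕ} : half ((first l + 1) :: l) = half l + 3 := by
  simp only [half, List.length_cons, totalDecrease_cons]
  omega

theorem half_cons_pred {l : List ℕ} : half ((first l - 1) :: l) = half l + 1 := by
  simp only [half, List.length_cons, totalDecrease_cons]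
  omega

theorem last_cons {a : ℕ} {l : List ℕ} (h : l ≠ []) : last (a :: l) = last l := by
  cases l with
  | nil => exact absurd rfl h
  | cons b l => exact last_cons_cons a b l

theorem hasSum_geometric {a b c d : ℕ} :
    HasSum (fun n : ℕ => mon 1 a b c d ^ n) (PowerSeries.invOfUnit (1 - mon 1 a b c d) 1) := by
  have h0 : PowerSeries.constantCoeff (mon 1 a b c d) = 0 := by
    rw [mon, ← PowerSeries.coeff_zero_eq_constantCoeff_apply, PowerSeries.coeff_monomial, if_neg]
    omega
  have h1 := PowerSeries.WithPiTopology.summable_pow_of_constantCoeff_eq_zero h0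
  have h2 := PowerSeries.WithPiTopology.tsum_pow_mul_one_sub_of_constantCoeff_eq_zero h0
  have h3 := PowerSeries.mul_invOfUnit (1 - mon 1 a b c d) 1 (by simp [h0])
  have h4 : ∑' n : ℕ, mon 1 a b c d ^ n = PowerSeries.invOfUnit (1 - mon 1 a b c d) 1 := by
    calc _ = (∑' n : ℕ, mon 1 a b c d ^ n) * ((1 - mon 1 a b c d) *
          PowerSeries.invOfUnit (1 - mon 1 a b c d) 1) := by rw [h3, mul_one]
      _ = _ := by rw [← mul_assoc, h2, one_mul]
  rw [← h4]
  exact h1.hasSum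

/-- Columns are added in front, so here `v` marks the first size and `u` the last; reversal
exchanges the two. The three terms of the equation are the three cases of `oscSizes_eq`, each weight
being multiplied by `q v`. -/
theorem functionalEquation_of_hasSum {F : Ser}
    (hF : HasSum (oscSizes.indicator fun l => mon l.sum l.length (last l) (first l) (half l)) F) :
    FunctionalEquation F := by
  -- The substitution `v ↦ v q` adds a second copy of the first column to the area. The prefactors
  -- `q v` and `1 / (q v)` then adjust it by one cell.
  have hsub : HasSum (oscSizes.indicator fun l =>
      mon (l.sum + first l) l.length (last l) (first l) (half l)) (substVQ F) :=
    HasSum.indicator_substitute _ 1 hF fun l _ => substVQ_mon ..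
  -- These are the terms to be removed, since no column of size zero may be added.
  have hone : HasSum ({l | l ∈ oscSizes ∧ first l = 1}.indicator fun l =>
      mon (l.sum + first l) l.length (last l) (first l) (half l))
      (var .v * extract .v 1 (substVQ F)) := by
    refine HasSum.indicator_mul_left _ (HasSum.indicator_extract .v 1 first hsub
      fun _ _ => extract_v_mon ..) ?_
    rintro l ⟨-, hl⟩
    rw [var_v, mon_mul, hl]
    congr 1 <;> ring
  have htwo : HasSum ({l | l ∈ oscSizes ∧ ¬first l = 1}.indicator fun l =>
      mon (l.sum + first l) l.length (last l) (first l) (half l))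
      (substVQ F - var .v * extract .v 1 (substVQ F)) := by
    refine Eq.subst (motive := fun f => HasSum f _) ?_ (hsub.sub hone)
    ext1 l
    by_cases h1 : l ∈ oscSizes <;> by_cases h2 : first l = 1 <;> simp [h1, h2]
  have hone' : HasSum ((univ : Set ℕ).indicator fun n =>
      q * var .v * mon [n + 1].sum [n + 1].length (last [n + 1]) (first [n + 1]) (half [n + 1]))
      (q * var .v * (var .x * q * var .u * var .v * var .t ^ 3 *
        PowerSeries.invOfUnit (1 - q * var .u * var .v * var .t ^ 2) 1)) := by
    rw [indicator_univ]
    have hr : q * var .u * var .v * var .t ^ 2 = mon 1 0 1 1 2 := by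
      simp [mon_eq]
      ring
    rw [hr]
    refine Eq.subst (motive := fun f => HasSum f _) ?_ ((hasSum_geometric.mul_left
      (var .x * q * var .u * var .v * var .t ^ 3)).mul_left (q * var .v))
    ext1 n
    simp only [half, q_eq, var_x, var_u, var_v, var_t, mon_mul, mon_pow, List.sum_cons,
      List.sum_nil, List.length_singleton, last_singleton, first_cons, first_nil,
      totalDecrease_cons, totalDecrease_nil]
    congr 1 <;> omega
  have hup : HasSum (oscSizes.indicator fun l => q * var .v * mon ((first l + 1) :: l).sum
      ((first l + 1) :: l).length (last ((first l + 1) :: l)) (first ((first l + 1) :: l))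
      (half ((first l + 1) :: l)))
      (q * var .v * (var .x * q * var .v * var .t ^ 3 * substVQ F)) := by
    rw [← mul_assoc]
    refine HasSum.indicator_mul_left _ hsub fun l hl => ?_
    rw [half_cons_succ, last_cons hl.1.1]
    simp only [q_eq, var_x, var_v, var_t, mon_mul, mon_pow, List.sum_cons,
      List.length_cons, first_cons]
    congr 1 <;> omega
  have hdown : HasSum ({l | l ∈ oscSizes ∧ ¬first l = 1}.indicator fun l =>
      q * var .v * mon ((first l - 1) :: l).sum
      ((first l - 1) :: l).length (last ((first l - 1) :: l)) (first ((first l - 1) :: l))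
      (half ((first l - 1) :: l)))
      (var .x * var .t * (substVQ F - var .v * extract .v 1 (substVQ F))) := by
    refine HasSum.indicator_mul_left _ htwo ?_
    rintro l ⟨hl, hl1⟩
    rw [half_cons_pred, last_cons hl.1.1]
    have hpos : 0 < first l := by
      cases l with
      | nil => exact absurd rfl hl.1.1
      | cons a l => exact pos_of_mem_sizes hl.1
    simp only [q_eq, var_x, var_v, var_t, mon_mul, List.sum_cons,
      List.length_cons, first_cons]
    congr 1 <;> omega
  have hall : HasSum (oscSizes.indicator fun l =>
      q * var .v * mon l.sum l.length (last l) (first l) (half l)) (q * var .v * F) :=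
    HasSum.indicator_mul_left _ hF fun l _ => rfl
  rw [FunctionalEquation]
  refine hall.unique ?_
  have hinj : ∀ {s : Set (List ℕ)} (φ : List ℕ → ℕ), InjOn (fun l => φ l :: l) s :=
    fun φ a _ b _ h => (List.cons.inj h).2
  rw [hasSum_bijOn (InjOn.bijOn_image (f := fun n : ℕ => [n + 1]) fun a _ b _ h => by simpa using h)
    (g := fun l => q * var .v * mon l.sum l.length (last l) (first l) (half l))
    (fun _ _ => rfl)] at hone'
  rw [hasSum_bijOn (InjOn.bijOn_image (hinj fun l => first l + 1))
    (g := fun l => q * var .v * mon l.sum l.length (last l) (first l) (half l))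
    (fun _ _ => rfl)] at hup
  rw [hasSum_bijOn (InjOn.bijOn_image (hinj fun l => first l - 1))
    (g := fun l => q * var .v * mon l.sum l.length (last l) (first l) (half l))
    (fun _ _ => rfl)] at hdown
  refine HasSum.indicator_congr (HasSum.indicator_union (HasSum.indicator_union hone' hup ?_)
    hdown ?_) oscSizes_eq.symm fun _ _ => rfl
  · rw [Set.disjoint_left]
    rintro _ ⟨n, -, rfl⟩ ⟨l, hl, h⟩
    exact hl.1.1 (List.cons.inj h).2
  · rw [Set.disjoint_left]
    rintro _ (⟨n, -, rfl⟩ | ⟨l', hl', rfl⟩) ⟨l, hl, h⟩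
    · exact hl.1.1.1 (List.cons.inj h).2
    · obtain ⟨h1, rfl⟩ := List.cons.inj h
      omega

/-! ### Decompositions -/

/-- `F i` collects the lists whose increasing part ends with a column of size `i`. The oscillating
part then starts with size `i - 1`, which must be positive; hence `2 ≤ i`. -/
theorem exists_formalSum_split {C H E : Ser}
    (hC : HasSum (decSizes.indicator fun l => mon l.sum l.length 0 (first l) (half l)) C)
    (hH : HasSum (oscSizes.indicator fun l => mon l.sum l.length (first l) (last l) (half l)) H)
    (hE : HasSum (weakSizes.indicator fun l => mon l.sum l.length 0 (last l) (half l)) E) :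
    ∃ F : ℕ → Ser, (∀ i ≥ 2, var .t ^ (2 * i - 2) * F i = extract .v i C * extract .u (i - 1) H) ∧
      HasFormalSum {i | 2 ≤ i} F E := by
  rw [← hasSum_bijOn bijOn_split (fun _ _ => rfl)] at hE
  obtain ⟨F, hF, hFE⟩ := exists_hasFormalSum hE (fun p => first p.1) (s := {i | 2 ≤ i}) (by
    rintro ⟨m, l⟩ ⟨-, hl, hml⟩
    dsimp only at hl hml
    cases l with
    | nil => exact absurd rfl hl.1.1
    | cons a l =>
      have := pos_of_mem_sizes hl.1
      simp only [first_cons] at hml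
      simp only [mem_ofPred_eq]
      omega)
  refine ⟨F, fun i hi => ?_, hFE⟩
  have h1 := extract_first hC i
  have h2 : HasSum ({l | l ∈ oscSizes ∧ first l = i - 1}.indicator fun l =>
      mon l.sum l.length 0 (last l) (half l)) (extract .u (i - 1) H) :=
    HasSum.indicator_extract .u (i - 1) first hH fun _ _ => extract_u_mon ..
  refine HasSum.unique (HasSum.indicator_mul_left _ (hF i) fun _ _ => rfl)
    (HasSum.indicator_congr (HasSum.indicator_prod h1 h2) ?_ ?_)
  · ext ⟨m, l⟩
    simp only [splitPairs, mem_prod, mem_ofPred_eq]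
    constructor
    · rintro ⟨⟨h3, rfl⟩, h4, h5⟩
      exact ⟨⟨h3, h4, by omega⟩, rfl⟩
    · rintro ⟨⟨h3, h4, h5⟩, rfl⟩
      exact ⟨⟨h3, rfl⟩, h4, by omega⟩
  · rintro p ⟨hp, rfl⟩
    have h3 := half_split hp
    rw [mon_mul, var_t, mon_pow, mon_mul, last_append _ hp.2.1.1.1]
    simp only [List.sum_append, List.sum_reverse, List.length_append, List.length_reverse]
    congr 1 <;> omega

/-- `F i` collects the palindromes with central column of size `i`. -/
theorem exists_formalSum_palindromes {C E S : Ser}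
    (hC : HasSum (decSizes.indicator fun l => mon l.sum l.length 0 (first l) (half l)) C)
    (hE : HasSum (weakSizes.indicator fun l => mon l.sum l.length 0 (last l) (half l)) E)
    (hS : HasSum (palindromes.indicator fun l => mon l.sum 0 0 0 (half l)) S) :
    ∃ F : ℕ → Ser, (∀ i ≥ 1, q ^ i * var .t ^ (2 * i + 1) * F i
        = substOneSqSq (extract .v i C + extract .v i E)) ∧ HasFormalSum {i | 1 ≤ i} F S := by
  rw [← hasSum_bijOn bijOn_palindromes (fun _ _ => rfl)] at hS
  obtain ⟨F, hF, hFS⟩ := exists_hasFormalSum hS first (s := {i | 1 ≤ i}) (by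
    rintro m ⟨hm, -⟩
    cases m with
    | nil => exact absurd rfl hm.1.1
    | cons a l => exact pos_of_mem_sizes hm.1)
  refine ⟨F, fun i hi => ?_, hFS⟩
  -- The left halves are read backwards, so that `v` marks the central column as the first entry.
  have hE' : HasSum ({m | m.reverse ∈ weakSizes}.indicator fun l =>
      mon l.sum l.length 0 (first l) (half l)) E := by
    have hb : BijOn List.reverse {m : List ℕ | m.reverse ∈ weakSizes} weakSizes :=
      ⟨fun m hm => hm, fun a _ b _ h => List.reverse_inj.1 h,
        fun l hl => ⟨l.reverse, by simpa using hl, by simp⟩⟩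
    rw [hasSum_bijOn hb]
    · exact hE
    · intro m _
      rw [List.sum_reverse, List.length_reverse, last_reverse, half_reverse]
  have hu := HasSum.indicator_union hC hE' (by
    rw [Set.disjoint_left]
    exact fun m hm hm' => not_mem_decSizes_of_reverse_mem hm' hm)
  rw [← halves_eq] at hu
  have h1 := extract_first hu i
  rw [extract_add] at h1
  refine HasSum.unique (HasSum.indicator_mul_left _ (hF i) fun _ _ => rfl)
    (HasSum.indicator_substitute _ 2 h1 ?_)
  rintro m ⟨hm, rfl⟩
  have h2 := sum_palindrome hm.1.1.1
  have h3 := half_palindrome hm.1.1.1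
  refine (substOneSqSq_mon ..).trans ?_
  rw [q_eq, var_t, mon_pow, mon_pow, mon_mul, mon_mul]
  congr 1 <;> omega

/-! ### Symmetric column-convex sets of cells -/

/-- `P` is symmetric about height zero with columns of consecutive cells, of sizes `N`. -/
def HasProfile (P : Finset Cell) (N : ℤ → ℕ) : Prop :=
  (∀ c, c ∈ P ↔ |height c| < N c.1) ∧ ∀ x, 0 < N x → ((N x : ℤ) + x) % 2 = 1

theorem height_mk (x b : ℤ) : height (x, b) = 2 * b + x := rfl

theorem HasProfile.mem_mk {P : Finset Cell} {N : ℤ → ℕ} (h : HasProfile P N) (x b : ℤ) :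
    (x, b) ∈ P ↔ -(N x : ℤ) < 2 * b + x ∧ 2 * b + x < N x := by
  rw [h.1, abs_lt, height_mk]

theorem HasProfile.isTop_iff {P : Finset Cell} {N : ℤ → ℕ} (h : HasProfile P N) (c : Cell) :
    IsTop P c ↔ 0 < N c.1 ∧ height c = N c.1 - 1 := by
  obtain ⟨x, b⟩ := c
  rw [height_mk, IsTop, h.mem_mk]
  have hpar := h.2 x
  constructor
  · rintro ⟨h1, h2⟩
    refine ⟨by dsimp only; omega, ?_⟩
    by_contra hne
    have := h2 (x, b + 1) ((h.mem_mk ..).2 (by dsimp only at hne; omega)) rfl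
    dsimp only at this
    omega
  · rintro ⟨h1, h2⟩
    dsimp only at h1 h2 ⊢
    refine ⟨by omega, ?_⟩
    rintro ⟨y, b'⟩ hd rfl
    rw [h.mem_mk] at hd
    dsimp only at h1 h2 ⊢
    omega

theorem HasProfile.isBottom_iff {P : Finset Cell} {N : ℤ → ℕ} (h : HasProfile P N) (c : Cell) :
    IsBottom P c ↔ 0 < N c.1 ∧ height c = 1 - N c.1 := by
  obtain ⟨x, b⟩ := c
  rw [height_mk, IsBottom, h.mem_mk]
  have hpar := h.2 x
  constructor
  · rintro ⟨h1, h2⟩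
    refine ⟨by dsimp only; omega, ?_⟩
    by_contra hne
    have := h2 (x, b - 1) ((h.mem_mk ..).2 (by dsimp only at hne; omega)) rfl
    dsimp only at this
    omega
  · rintro ⟨h1, h2⟩
    dsimp only at h1 h2 ⊢
    refine ⟨by omega, ?_⟩
    rintro ⟨y, b'⟩ hd rfl
    rw [h.mem_mk] at hd
    dsimp only at h1 h2 ⊢
    omega

/-- The differences between the sizes of consecutive columns. -/
def growths (N : ℤ → ℕ) : Set ℤ :=
  {z | ∃ x, 0 < N x ∧ 0 < N (x + 1) ∧ z = (N (x + 1) : ℤ) - N x}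

/-- The top cell of a column of size `n` has height `n - 1`, so growths of the profile are
differences of sizes. -/
theorem HasProfile.upperGrowths_eq {P : Finset Cell} {N : ℤ → ℕ} (h : HasProfile P N) :
    upperGrowths P = growths N := by
  ext z
  simp only [upperGrowths, growths, mem_ofPred_eq, h.isTop_iff]
  constructor
  · rintro ⟨c, d, ⟨h1, h2⟩, ⟨h3, h4⟩, h5, rfl⟩
    rw [h5] at h3 h4
    exact ⟨c.1, h1, h3, by omega⟩
  · rintro ⟨x, h1, h2, rfl⟩
    have p1 := h.2 x h1
    have p2 := h.2 (x + 1) h2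
    refine ⟨(x, (N x - 1 - x) / 2), (x + 1, (N (x + 1) - 1 - (x + 1)) / 2), ⟨h1, ?_⟩, ⟨h2, ?_⟩,
      rfl, ?_⟩ <;> simp only [height_mk] <;> omega

theorem HasProfile.lowerGrowths_eq {P : Finset Cell} {N : ℤ → ℕ} (h : HasProfile P N) :
    lowerGrowths P = growths N := by
  ext z
  simp only [lowerGrowths, growths, mem_ofPred_eq, h.isBottom_iff]
  constructor
  · rintro ⟨c, d, ⟨h1, h2⟩, ⟨h3, h4⟩, h5, rfl⟩
    rw [h5] at h3 h4
    exact ⟨c.1, h1, h3, by omega⟩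
  · rintro ⟨x, h1, h2, rfl⟩
    have p1 := h.2 x h1
    have p2 := h.2 (x + 1) h2
    refine ⟨(x, (1 - N x - x) / 2), (x + 1, (1 - N (x + 1) - (x + 1)) / 2), ⟨h1, ?_⟩, ⟨h2, ?_⟩,
      rfl, ?_⟩ <;> simp only [height_mk] <;> omega

/-- Convexity along the lines of slope `ε`, in terms of the column sizes. -/
def LineConvex (ε : ℤ) (N : ℤ → ℕ) : Prop :=
  ∀ m x₁ x x₂ : ℤ, x₁ ≤ x → x ≤ x₂ → |ε * x₁ + 2 * m| < N x₁ → |ε * x₂ + 2 * m| < N x₂ →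
    |ε * x + 2 * m| < N x

theorem HasProfile.convexCells_iff {P : Finset Cell} {N : ℤ → ℕ} (h : HasProfile P N) :
    ConvexCells P ↔ LineConvex 1 N ∧ LineConvex (-1) N := by
  have e1 : ∀ (c : Cell) (k : ℤ), c + k • ((1, 0) : Cell) ∈ P
      ↔ |1 * (c.1 + k) + 2 * c.2| < N (c.1 + k) := by
    rintro ⟨x, b⟩ k
    rw [h.1]
    simp [height]
    ring_nf
  have e2 : ∀ (c : Cell) (k : ℤ), c + k • ((1, -1) : Cell) ∈ P
      ↔ |-1 * (c.1 + k) + 2 * (c.2 + c.1)| < N (c.1 + k) := by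
    rintro ⟨x, b⟩ k
    rw [h.1]
    simp [height]
    ring_nf
  have e3 : ∀ (c : Cell) (k : ℤ), c + k • ((0, 1) : Cell) ∈ P
      ↔ -(N c.1 : ℤ) < 2 * (c.2 + k) + c.1 ∧ 2 * (c.2 + k) + c.1 < N c.1 := by
    rintro ⟨x, b⟩ k
    rw [← h.mem_mk]
    simp
  simp only [ConvexCells, Finset.mem_insert, Finset.mem_singleton, forall_eq_or_imp, forall_eq,
    e1, e2, e3, ordConnected_def, mem_ofPred_eq]
  constructor
  · rintro ⟨-, h1, h2⟩
    constructor
    · intro m x₁ x x₂ hx1 hx2 a1 a2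
      have := h1 (0, m) (x := x₁) (by simpa using a1) (y := x₂) (by simpa using a2) ⟨hx1, hx2⟩
      simpa using this
    · intro m x₁ x x₂ hx1 hx2 a1 a2
      have := h2 (0, m) (x := x₁) (by simpa using a1) (y := x₂) (by simpa using a2) ⟨hx1, hx2⟩
      simpa using this
  · rintro ⟨h1, h2⟩
    refine ⟨?_, ?_, ?_⟩
    · intro c k₁ a1 k₂ a2 k hk
      obtain ⟨hk1, hk2⟩ := hk
      simp only [mem_ofPred_eq] at a1 a2 ⊢
      omega
    · intro c k₁ a1 k₂ a2 k hk
      exact h1 c.2 (c.1 + k₁) _ (c.1 + k₂) (by linarith [hk.1]) (by linarith [hk.2]) a1 a2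
    · intro c k₁ a1 k₂ a2 k hk
      exact h2 (c.2 + c.1) (c.1 + k₁) _ (c.1 + k₂) (by linarith [hk.1]) (by linarith [hk.2]) a1 a2

/-! ### Connectedness -/

/-- A path changes column by at most one at each step, so it cannot jump over `x`. -/
theorem exists_column_of_connected {P : Finset Cell} (hP : Connected P) {c d : Cell} (hc : c ∈ P)
    (hd : d ∈ P) {x : ℤ} (hcx : c.1 ≤ x) (hxd : x ≤ d.1) : ∃ e ∈ P, e.1 = x := by
  by_contra hne
  push Not at hne
  have hr := hP.preconnected ⟨c, hc⟩ ⟨d, hd⟩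
  rw [SimpleGraph.reachable_iff_reflTransGen] at hr
  have key : ∀ e : (P : Set Cell), Relation.ReflTransGen
      (hexGraph.induce (P : Set Cell)).Adj ⟨c, hc⟩ e → e.1.1 < x := by
    intro e he
    induction he with
    | refl => exact lt_of_le_of_ne hcx (hne c hc)
    | @tail a b _ hab ih =>
      have hstep : ∀ e ∈ steps, e.1 ≤ 1 := by decide
      have h1 : b.1 - a.1 ∈ steps := hab
      have h2 := hstep _ h1
      have h3 := hne b.1 b.2
      rw [Prod.fst_sub] at h2
      omega
  have := key _ hr
  simp only at this
  omega

theorem HasProfile.connected {P : Finset Cell} {N : ℤ → ℕ} (h : HasProfile P N) {x₀ : ℤ}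
    (h0 : 0 < N x₀) (hN : ∀ x₁ x x₂, x₁ ≤ x → x ≤ x₂ → 0 < N x₁ → 0 < N x₂ → 0 < N x) :
    Connected P := by
  -- This cell has height zero or one according to the parity of `x`. If `x` is odd then `N x` is
  -- even, hence at least two. These central cells serve as a spine: each cell descends or climbs to
  -- it within its column, and consecutive ones are adjacent.
  have hz : ∀ x, 0 < N x → (x, -(x / 2)) ∈ P := by
    intro x hx
    have := h.2 x hx
    rw [h.mem_mk]
    omega
  have hpos : ∀ x b, (x, b) ∈ P → 0 < N x := by
    intro x b hx
    rw [h.mem_mk] at hx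
    omega
  have hcol : ∀ (k : ℕ) (x b : ℤ) (hb : (x, b) ∈ P), (b + x / 2).natAbs = k →
      (hexGraph.induce (P : Set Cell)).Reachable ⟨(x, b), hb⟩ ⟨_, hz x (hpos x b hb)⟩ := by
    intro k
    induction k with
    | zero =>
      intro x b hb hk
      obtain rfl : b = -(x / 2) := by omega
      exact SimpleGraph.Reachable.refl _
    | succ k ih =>
      intro x b hb hk
      have hb' := (h.mem_mk ..).1 hb
      rcases lt_or_ge 0 (b + x / 2) with hlt | hle
      · have hm : (x, b - 1) ∈ P := by
          rw [h.mem_mk]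
          omega
        refine SimpleGraph.Reachable.trans (SimpleGraph.Adj.reachable (v := ⟨(x, b - 1), hm⟩) ?_)
          (ih x (b - 1) hm (by omega))
        change ((x, b - 1) : Cell) - (x, b) ∈ steps
        simp [steps]
      · have hm : (x, b + 1) ∈ P := by
          rw [h.mem_mk]
          omega
        refine SimpleGraph.Reachable.trans (SimpleGraph.Adj.reachable (v := ⟨(x, b + 1), hm⟩) ?_)
          (ih x (b + 1) hm (by omega))
        change ((x, b + 1) : Cell) - (x, b) ∈ steps
        simp [steps]
  have hrow : ∀ (k : ℕ) (x : ℤ) (h1 : 0 < N x) (h2 : 0 < N (x + k)),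
      (hexGraph.induce (P : Set Cell)).Reachable ⟨_, hz x h1⟩ ⟨_, hz (x + k) h2⟩ := by
    intro k
    induction k with
    | zero =>
      intro x h1 h2
      simp
    | succ k ih =>
      intro x h1 h2
      have h3 : 0 < N (x + k) := hN x _ (x + (k + 1 : ℕ)) (by omega) (by omega) h1 h2
      refine (ih x h1 h3).trans (SimpleGraph.Adj.reachable ?_)
      change ((x + (k + 1 : ℕ), -((x + (k + 1 : ℕ)) / 2)) : Cell) - (x + k, -((x + k) / 2)) ∈ steps
      have : -((x + (k + 1 : ℕ)) / 2) - -((x + k) / 2) = 0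
          ∨ -((x + (k + 1 : ℕ)) / 2) - -((x + k) / 2) = -1 := by omega
      have h5 : x + (k + 1 : ℕ) - (x + k) = 1 := by push_cast; ring
      rw [Prod.mk_sub_mk, h5]
      rcases this with h6 | h6 <;> rw [h6] <;> decide
  have hcenter : ∀ c : (P : Set Cell), (hexGraph.induce (P : Set Cell)).Reachable c ⟨_, hz x₀ h0⟩ := by
    rintro ⟨⟨x, b⟩, hb⟩
    have hx := hpos x b hb
    refine (hcol _ x b hb rfl).trans ?_
    rcases le_total x x₀ with hle | hle
    · obtain ⟨k, rfl⟩ := Int.le.dest hle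
      exact hrow k x hx h0
    · obtain ⟨k, rfl⟩ := Int.le.dest hle
      exact (hrow k x₀ h0 hx).symm
  have : Nonempty (P : Set Cell) := ⟨⟨_, hz x₀ h0⟩⟩
  exact SimpleGraph.Connected.mk fun c d => (hcenter c).trans (hcenter d).symm

/-! ### The cells of a sequence of column sizes -/

/-- The column sizes, from the abscissa `a` on. -/
def colSize : ℤ → List ℕ → ℤ → ℕ
  | _, [], _ => 0
  | a, n :: l, x => if x = a then n else colSize (a + 1) l x

/-- `n` consecutive cells in column `x`, centred at height zero if `n + x` is odd. -/
noncomputable def column (x : ℤ) (n : ℕ) : Finset Cell :=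
  (Finset.Ico ((1 - n - x) / 2) ((1 - n - x) / 2 + n)).map (Function.Embedding.sectR x ℤ)

/-- The columns with the given sizes, from the abscissa `a` on. -/
noncomputable def cells : ℤ → List ℕ → Finset Cell
  | _, [] => ∅
  | a, n :: l => column a n ∪ cells (a + 1) l

theorem mem_column {x : ℤ} {n : ℕ} (h : ((n : ℤ) + x) % 2 = 1) {c : Cell} :
    c ∈ column x n ↔ c.1 = x ∧ |height c| < n := by
  obtain ⟨y, b⟩ := c
  simp only [column, Finset.mem_map, Function.Embedding.sectR_apply, Prod.mk.injEq, Finset.mem_Ico,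
    height_mk, abs_lt]
  constructor
  · rintro ⟨b, hb, rfl, rfl⟩
    exact ⟨rfl, by omega⟩
  · rintro ⟨rfl, hb⟩
    exact ⟨b, by omega, rfl, rfl⟩

theorem colSize_of_lt {a x : ℤ} (l : List ℕ) (h : x < a) : colSize a l x = 0 := by
  induction l generalizing a with
  | nil => rfl
  | cons n l ih => rw [colSize, if_neg h.ne, ih (by omega)]

theorem colSize_of_ge {a x : ℤ} (l : List ℕ) (h : a + l.length ≤ x) : colSize a l x = 0 := by
  induction l generalizing a with
  | nil => rfl
  | cons n l ih =>
    rw [List.length_cons] at h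
    rw [colSize, if_neg (by omega), ih (by omega)]

theorem colSize_pos {a x : ℤ} {l : List ℕ} (hl : ∀ n ∈ l, 0 < n) (h1 : a ≤ x)
    (h2 : x < a + l.length) : 0 < colSize a l x := by
  induction l generalizing a with
  | nil => simp at h2; omega
  | cons n l ih =>
    rw [List.length_cons] at h2
    rw [colSize]
    split_ifs with h
    · exact hl n (by simp)
    · exact ih (fun m hm => hl m (by simp [hm])) (by omega) (by omega)

theorem colSize_pos_iff {a x : ℤ} {l : List ℕ} (hl : ∀ n ∈ l, 0 < n) :
    0 < colSize a l x ↔ a ≤ x ∧ x < a + l.length := by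
  refine ⟨fun h => ⟨?_, ?_⟩, fun h => colSize_pos hl h.1 h.2⟩
  · by_contra hx
    rw [colSize_of_lt l (by omega)] at h
    omega
  · by_contra hx
    rw [colSize_of_ge l (by omega)] at h
    omega

theorem colSize_self (a : ℤ) (l : List ℕ) : colSize a l a = first l := by
  cases l with
  | nil => rfl
  | cons n l => rw [colSize, if_pos rfl, first_cons]

theorem colSize_cons_of_lt {a x : ℤ} (n : ℕ) (l : List ℕ) (h : a < x) :
    colSize a (n :: l) x = colSize (a + 1) l x := by
  rw [colSize, if_neg h.ne']

theorem colSize_add (a s x : ℤ) (l : List ℕ) : colSize (a + s) l (x + s) = colSize a l x := by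
  induction l generalizing a with
  | nil => rfl
  | cons n l ih =>
    simp only [colSize, add_left_inj, add_right_comm a s, ih]

theorem colSize_concat (a x : ℤ) (l : List ℕ) (n : ℕ) :
    colSize a (l ++ [n]) x = if x = a + l.length then n else colSize a l x := by
  induction l generalizing a with
  | nil => simp [colSize]
  | cons m l ih =>
    rw [List.cons_append, colSize, colSize, ih, List.length_cons]
    push_cast
    by_cases h : x = a
    · rw [if_pos h, if_pos h, if_neg (by omega)]
    · rw [if_neg h, if_neg h, add_assoc, add_comm (1 : ℤ)]

/-- The last column stands at `a + l.length - 1`, and its mirror image is where the reversed list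
begins. -/
theorem colSize_reverse (a x : ℤ) (l : List ℕ) :
    colSize (1 - a - l.length) l.reverse x = colSize a l (-x) := by
  induction l generalizing a with
  | nil => rfl
  | cons n l ih =>
    rw [List.reverse_cons, colSize_concat, colSize, ← ih, List.length_reverse, List.length_cons]
    push_cast
    have h : x = 1 - a - ((l.length : ℤ) + 1) + l.length ↔ -x = a := by omega
    simp only [h]
    congr 2
    ring

theorem colSize_last (a : ℤ) (l : List ℕ) :
    colSize a l (a + l.length - 1) = last l := by
  have h := colSize_reverse a (1 - a - l.length) l
  rw [colSize_self, first_reverse] at h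
  rw [h]
  congr 1
  ring

theorem colSize_injective {a : ℤ} {l l' : List ℕ} (hl : ∀ n ∈ l, 0 < n) (hl' : ∀ n ∈ l', 0 < n)
    (h : ∀ x, colSize a l x = colSize a l' x) : l = l' := by
  induction l generalizing a l' with
  | nil =>
    cases l' with
    | nil => rfl
    | cons n l' =>
      have h1 := h a
      rw [colSize_self, colSize_self] at h1
      have := hl' n (by simp)
      simp only [first_nil, first_cons] at h1
      omega
  | cons m l ih =>
    cases l' with
    | nil =>
      have h1 := h a
      rw [colSize_self, colSize_self] at h1
      have := hl m (by simp)
      simp only [first_nil, first_cons] at h1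
      omega
    | cons n l' =>
      have h1 := h a
      rw [colSize_self, colSize_self] at h1
      rw [show m = n from h1, ih (a := a + 1) (l' := l') (fun k hk => hl k (by simp [hk]))
        (fun k hk => hl' k (by simp [hk]))]
      intro x
      rcases lt_or_ge a x with hx | hx
      · rw [← colSize_cons_of_lt m l hx, ← colSize_cons_of_lt n l' hx, h]
      · rw [colSize_of_lt _ (by omega), colSize_of_lt _ (by omega)]

theorem sizes_tail {n : ℕ} {l : List ℕ} (h : n :: l ∈ sizes) (hl : l ≠ []) :
    l ∈ sizes ∧ (n + first l) % 2 = 1 := by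
  cases l with
  | nil => exact absurd rfl hl
  | cons m l =>
    have := mem_sizes_cons_cons.1 h
    exact ⟨this.2.2, this.2.1⟩

theorem hasProfile_cells {a : ℤ} {l : List ℕ} (hl : l ∈ sizes) (ha : ((first l : ℤ) + a) % 2 = 1) :
    HasProfile (cells a l) (colSize a l) := by
  induction l generalizing a with
  | nil => exact absurd rfl hl.1
  | cons n l ih =>
    by_cases hne : l = []
    · subst hne
      constructor
      · intro c
        rw [first_cons] at ha
        rw [cells, cells, Finset.union_empty, mem_column ha, colSize, colSize]
        split_ifs with h
        · simp [h]
        · simp [h]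
      · intro x hx
        rw [colSize, colSize] at hx ⊢
        split_ifs at hx ⊢ with h
        · rw [h]
          exact ha
        · omega
    · obtain ⟨h1, h2⟩ := sizes_tail hl hne
      rw [first_cons] at ha
      have h3 := ih (a := a + 1) h1 (by omega)
      constructor
      · intro c
        rw [cells, Finset.mem_union, mem_column ha, h3.1, colSize]
        split_ifs with h
        · rw [h, colSize_of_lt l (by omega)]
          simp
        · simp [h]
      · intro x hx
        rw [colSize] at hx ⊢
        split_ifs at hx ⊢ with h
        · rw [h]
          exact ha
        · exact h3.2 x hx

theorem disjoint_column_cells (a : ℤ) (n : ℕ) {b : ℤ} (l : List ℕ) (h : a < b) :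
    Disjoint (column a n) (cells b l) := by
  have key : ∀ c ∈ cells b l, b ≤ c.1 := by
    clear h
    induction l generalizing b with
    | nil => simp [cells]
    | cons m l ih =>
      intro c hc
      rw [cells, Finset.mem_union] at hc
      rcases hc with hc | hc
      · simp only [column, Finset.mem_map, Function.Embedding.sectR_apply] at hc
        obtain ⟨y, -, rfl⟩ := hc
        exact le_rfl
      · have := ih c hc
        omega
  rw [Finset.disjoint_left]
  intro c hc hc'
  have := key c hc'
  simp only [column, Finset.mem_map, Function.Embedding.sectR_apply] at hc
  obtain ⟨y, -, rfl⟩ := hc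
  simp only at this
  omega

theorem card_cells (a : ℤ) (l : List ℕ) : (cells a l).card = l.sum := by
  induction l generalizing a with
  | nil => rfl
  | cons n l ih =>
    rw [cells, Finset.card_union_of_disjoint (disjoint_column_cells a n l (by omega)), ih,
      List.sum_cons]
    simp [column]

theorem mem_growths_colSize {a : ℤ} {l : List ℕ} (hl : ∀ n ∈ l, 0 < n) (z : ℤ) :
    z ∈ growths (colSize a l) ↔ z ∈ diffs l := by
  induction l generalizing a with
  | nil => simp [growths, colSize]
  | cons n l ih =>
    cases l with
    | nil =>
      simp only [growths, colSize_pos_iff hl, mem_ofPred_eq, List.length_singleton, diffs_singleton,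
        List.not_mem_nil, iff_false]
      rintro ⟨x, h1, h2, -⟩
      push_cast at h1 h2
      omega
    | cons m l =>
      rw [diffs_cons_cons, List.mem_cons, ← ih (a := a + 1) fun k hk => hl k (List.mem_cons_of_mem _ hk)]
      have h1 : colSize a (n :: m :: l) a = n := colSize_self ..
      have h2 : colSize a (n :: m :: l) (a + 1) = m := by
        rw [colSize_cons_of_lt _ _ (by omega), colSize_self, first_cons]
      constructor
      · rintro ⟨x, hx1, hx2, rfl⟩
        have := ((colSize_pos_iff hl).1 hx1).1
        rcases this.eq_or_lt with rfl | hlt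
        · exact Or.inl (by rw [h1, h2])
        · rw [colSize_cons_of_lt _ _ hlt] at hx1 ⊢
          rw [colSize_cons_of_lt _ _ (by omega)] at hx2 ⊢
          exact Or.inr ⟨x, hx1, hx2, rfl⟩
      · rintro (rfl | ⟨x, hx1, hx2, rfl⟩)
        · refine ⟨a, ?_, ?_, by rw [h1, h2]⟩
          · rw [h1]
            exact hl n (by simp)
          · rw [h2]
            exact hl m (by simp)
        · have : a < x := by
            by_contra hlt
            rw [colSize_of_lt _ (by omega)] at hx1
            omega
          refine ⟨x, ?_, ?_, ?_⟩
          · rwa [colSize_cons_of_lt _ _ this]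
          · rwa [colSize_cons_of_lt _ _ (by omega)]
          · rw [colSize_cons_of_lt n _ this, colSize_cons_of_lt n _ (by omega : a < x + 1)]

/-! ### Convexity in terms of the column sizes -/

/-- A pair of differences that may occur in this order by convexity along the lines of slope `ε`. -/
def UnimodalAlong (ε d d' : ℤ) : Prop := d < ε → d' ≤ ε

/-- For odd integers, `d < 1` means `d < 0` and `d' ≤ -1` means `d' < 0`, so the two slopes give the
two clauses of `Unimodal`. -/
theorem pairwise_unimodal_iff {l : List ℕ} (hl : l ∈ sizes) : (diffs l).Pairwise Unimodal
    ↔ (diffs l).Pairwise (UnimodalAlong 1) ∧ (diffs l).Pairwise (UnimodalAlong (-1)) := by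
  rw [← List.pairwise_and_iff]
  have hodd := hl.2.2
  constructor <;> intro h
  all_goals
    refine h.imp_of_mem fun {d d'} hd hd' h' => ?_
    have h1 := hodd d hd
    have h2 := hodd d' hd'
    simp only [Unimodal, UnimodalAlong] at h' ⊢
    omega

theorem colSize_antitone {ε a : ℤ} {l : List ℕ} (h : ∀ d ∈ diffs l, d ≤ ε) {x y : ℤ}
    (hax : a ≤ x) (hxy : x ≤ y) (hy : y < a + l.length) :
    (colSize a l y : ℤ) - ε * y ≤ colSize a l x - ε * x := by
  induction l generalizing a x with
  | nil => simp at hy; omega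
  | cons n l ih =>
    rcases hxy.eq_or_lt with rfl | hxy
    · exact le_rfl
    rw [List.length_cons] at hy
    push_cast at hy
    rw [colSize_cons_of_lt n l (hax.trans_lt hxy)]
    rcases hax.eq_or_lt with rfl | hax
    · cases l with
      | nil => simp at hy; omega
      | cons m l =>
        rw [diffs_cons_cons, List.forall_mem_cons] at h
        have h1 := ih h.2 (a := a + 1) (x := a + 1) (by omega) (by omega) (by omega)
        rw [colSize_self, first_cons] at h1 ⊢
        linarith [h.1]
    · rw [colSize_cons_of_lt n l hax]
      refine ih ?_ (by omega) hxy.le (by omega)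
      cases l with
      | nil => simp
      | cons m l =>
        rw [diffs_cons_cons, List.forall_mem_cons] at h
        exact h.2

/-- The function size minus `ε * x` cannot rise again after a fall, so on an interval it is at least
its smaller end value. -/
theorem colSize_quasiconcave {ε a : ℤ} {l : List ℕ} (h : (diffs l).Pairwise (UnimodalAlong ε))
    {x y z : ℤ} (hax : a ≤ x) (hxy : x ≤ y) (hyz : y ≤ z) (hz : z < a + l.length) :
    min ((colSize a l x : ℤ) - ε * x) (colSize a l z - ε * z) ≤ colSize a l y - ε * y := by
  induction l generalizing a x with
  | nil => simp at hz; omega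
  | cons n l ih =>
    rcases hxy.eq_or_lt with rfl | hxy
    · exact min_le_left _ _
    rw [List.length_cons] at hz
    push_cast at hz
    rw [colSize_cons_of_lt n l (hax.trans_lt hxy),
      colSize_cons_of_lt n l (hax.trans_lt (hxy.trans_le hyz))]
    rcases hax.eq_or_lt with rfl | hax
    · cases l with
      | nil => simp at hz; omega
      | cons m l =>
        rw [diffs_cons_cons, List.pairwise_cons] at h
        by_cases hd : (m : ℤ) - n < ε
        · refine (min_le_right _ _).trans (colSize_antitone (ε := ε) ?_ (by omega) hyz (by omega))
          exact fun d' hd' => h.1 d' hd' hd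
        · refine le_trans (min_le_min_right _ ?_)
            (ih h.2 (x := a + 1) (by omega) (by omega) (by omega))
          rw [colSize_self, colSize_self, first_cons, first_cons]
          linarith
    · rw [colSize_cons_of_lt n l hax]
      refine ih ?_ (by omega) hxy.le (by omega)
      cases l with
      | nil => simp
      | cons m l =>
        rw [diffs_cons_cons, List.pairwise_cons] at h
        exact h.2

/-- A line of slope `ε` meets a column if it passes below its upper end and above its lower end. The
first condition is a superlevel set for `ε`, the second one for `-ε`; this is why both hypotheses
are needed. -/
theorem lineConvex_of_pairwise {ε a : ℤ} {l : List ℕ} (hl : ∀ n ∈ l, 0 < n)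
    (h : (diffs l).Pairwise (UnimodalAlong ε)) (h' : (diffs l).Pairwise (UnimodalAlong (-ε))) :
    LineConvex ε (colSize a l) := by
  intro m x₁ x x₂ hx1 hx2 h1 h2
  have p1 : 0 < colSize a l x₁ := by
    have := (abs_nonneg _).trans_lt h1
    omega
  have p2 : 0 < colSize a l x₂ := by
    have := (abs_nonneg _).trans_lt h2
    omega
  have i1 := ((colSize_pos_iff hl).1 p1).1
  have i2 := ((colSize_pos_iff hl).1 p2).2
  have q1 := colSize_quasiconcave h i1 hx1 hx2 i2
  have q2 := colSize_quasiconcave h' i1 hx1 hx2 i2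
  rw [abs_lt] at h1 h2 ⊢
  rw [min_le_iff] at q1 q2
  constructor
  · rcases q2 with q2 | q2 <;> linarith [h1.1, h2.1]
  · rcases q1 with q1 | q1 <;> linarith [h1.2, h2.2]

/-- The line meets the polyomino at `x₀` and passes just above the top of column `a`: its height
there is `first l + 1`. As long as the differences equal `ε` it stays just above the profile, and a
first larger difference would make it enter the polyomino again. -/
theorem forall_diffs_le_of_lineConvex {ε : ℤ} (hε : ε = 1 ∨ ε = -1) {N : ℤ → ℕ}
    (hN : LineConvex ε N) {a x₀ m : ℤ} {l : List ℕ} (hl : l ∈ sizes)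
    (h : (diffs l).Pairwise (UnimodalAlong ε)) (hNl : ∀ x, a ≤ x → N x = colSize a l x)
    (hm : 2 * m = first l - ε * a + 1) (hx₀ : x₀ < a) (h₀ : |ε * x₀ + 2 * m| < N x₀) :
    ∀ d ∈ diffs l, d ≤ ε := by
  induction l generalizing a with
  | nil => simp
  | cons n l ih =>
    cases l with
    | nil => simp
    | cons k l =>
      obtain ⟨hn, hnk, hl'⟩ := mem_sizes_cons_cons.1 hl
      rw [diffs_cons_cons, List.pairwise_cons] at h
      rw [first_cons] at hm
      rw [diffs_cons_cons, List.forall_mem_cons]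
      rcases lt_trichotomy ((k : ℤ) - n) ε with hd | hd | hd
      · exact ⟨hd.le, fun d' hd' => h.1 d' hd' hd⟩
      · refine ⟨hd.le, ih (a := a + 1) hl' h.2 ?_ ?_ (by omega)⟩
        · intro x hx
          rw [hNl x (by omega), colSize_cons_of_lt _ _ (by omega)]
        · rw [first_cons]
          linarith
      · exfalso
        have e1 : N a = n := by rw [hNl a le_rfl, colSize_self, first_cons]
        have e2 : N (a + 1) = k := by
          rw [hNl (a + 1) (by omega), colSize_cons_of_lt _ _ (by omega), colSize_self, first_cons]
        have h1 := hN m x₀ a (a + 1) hx₀.le (by omega) h₀ (by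
          rw [e2, abs_lt]
          rcases hε with rfl | rfl <;> omega)
        rw [e1, abs_lt] at h1
        linarith [h1.2]

theorem pairwise_of_lineConvex {ε : ℤ} (hε : ε = 1 ∨ ε = -1) {a : ℤ} {l : List ℕ}
    (hl : l ∈ sizes) (ha : ((first l : ℤ) + a) % 2 = 1) (hN : LineConvex ε (colSize a l)) :
    (diffs l).Pairwise (UnimodalAlong ε) := by
  induction l generalizing a with
  | nil => simp
  | cons n l ih =>
    cases l with
    | nil => simp
    | cons k l =>
      obtain ⟨hn, hnk, hl'⟩ := mem_sizes_cons_cons.1 hl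
      have hk := pos_of_mem_sizes hl'
      rw [first_cons] at ha
      have htail : LineConvex ε (colSize (a + 1) (k :: l)) := by
        intro m x₁ x x₂ hx1 hx2 h1 h2
        have p1 : a + 1 ≤ x₁ := by
          by_contra hlt
          rw [colSize_of_lt _ (by omega)] at h1
          have := abs_nonneg (ε * x₁ + 2 * m)
          push_cast at h1
          omega
        rw [← colSize_cons_of_lt n _ (by omega : a < x₁)] at h1
        rw [← colSize_cons_of_lt n _ (by omega : a < x₂)] at h2
        rw [← colSize_cons_of_lt n _ (by omega : a < x)]
        exact hN m x₁ x x₂ hx1 hx2 h1 h2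
      have hp := ih (a := a + 1) hl' (by rw [first_cons]; omega) htail
      rw [diffs_cons_cons, List.pairwise_cons]
      refine ⟨fun d hd hlt => ?_, hp⟩
      -- The chosen line passes just above the top of column `a + 1`. Since the difference `k - n`
      -- is less than `ε`, and by parity at most `ε - 2`, it meets column `a`.
      refine forall_diffs_le_of_lineConvex hε hN (a := a + 1) (x₀ := a)
        (m := (k - ε * (a + 1) + 1) / 2) hl' hp (fun x hx => colSize_cons_of_lt _ _ (by omega))
        ?_ (by omega) ?_ d hd
      · rw [first_cons]
        rcases hε with rfl | rfl <;> omega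
      · rw [colSize_self, first_cons, abs_lt]
        rcases hε with rfl | rfl <;> omega

theorem convexCells_cells_iff {a : ℤ} {l : List ℕ} (hl : l ∈ sizes)
    (ha : ((first l : ℤ) + a) % 2 = 1) : ConvexCells (cells a l) ↔ l ∈ convexSizes := by
  rw [(hasProfile_cells hl ha).convexCells_iff, convexSizes, mem_ofPred_eq, pairwise_unimodal_iff hl]
  constructor
  · rintro ⟨h1, h2⟩
    exact ⟨hl, pairwise_of_lineConvex (Or.inl rfl) hl ha h1,
      pairwise_of_lineConvex (Or.inr rfl) hl ha h2⟩
  · rintro ⟨-, h1, h2⟩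
    exact ⟨lineConvex_of_pairwise hl.2.1 h1 h2,
      lineConvex_of_pairwise hl.2.1 h2 (by rwa [neg_neg])⟩

/-! ### The perimeter -/

theorem card_filter_not_mem_Ico {B B' : ℤ} {n m : ℕ}
    (h : m = 0 ∨ (B ≤ B' ∧ B' + m ≤ B + n) ∨ (B' ≤ B ∧ B + n ≤ B' + m)) :
    ((Finset.Ico B (B + n)).filter fun b => b ∉ Finset.Ico B' (B' + m)).card = n - m := by
  rw [Finset.filter_notMem_eq_sdiff]
  rcases h with rfl | ⟨h1, h2⟩ | ⟨h1, h2⟩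
  · simp
  · rw [Finset.card_sdiff_of_subset (Finset.Ico_subset_Ico h1 h2)]
    simp
  · rw [Finset.sdiff_eq_empty_iff_subset.2 (Finset.Ico_subset_Ico h1 h2), Finset.card_empty]
    omega

theorem HasProfile.card_column_filter {P : Finset Cell} {N : ℤ → ℕ} (h : HasProfile P N) {x : ℤ}
    (e : Cell) {B' : ℤ} (hB : B' = (1 - N (x + e.1) - (x + e.1)) / 2 - e.2) :
    ((column x (N x)).filter fun c => c + e ∉ P).card
      = ((Finset.Ico ((1 - N x - x) / 2) ((1 - N x - x) / 2 + N x)).filter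
          fun b => b ∉ Finset.Ico B' (B' + N (x + e.1))).card := by
  rw [column, Finset.filter_map, Finset.card_map]
  congr 1
  refine Finset.filter_congr fun b _ => ?_
  have hpar := h.2 (x + e.1)
  have : ((x, b) : Cell) + e = (x + e.1, b + e.2) := rfl
  simp only [Function.comp, Function.Embedding.sectR_apply, this, h.mem_mk, Finset.mem_Ico]
  omega

/-- Each column has two free horizontal edges. Towards a neighbouring column there are two
directions of edges, each with as many free edges as the truncated difference of the sizes. -/
theorem HasProfile.sum_column {P : Finset Cell} {N : ℤ → ℕ} (h : HasProfile P N) {x : ℤ}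
    (hx : 0 < N x) : ∑ c ∈ column x (N x), (steps.filter fun e => c + e ∉ P).card
      = 2 + 2 * (N x - N (x + 1)) + 2 * (N x - N (x - 1)) := by
  have hswap : ∑ c ∈ column x (N x), (steps.filter fun e => c + e ∉ P).card
      = ∑ e ∈ steps, ((column x (N x)).filter fun c => c + e ∉ P).card := by
    simp only [Finset.card_filter]
    exact Finset.sum_comm
  have hp := h.2 x hx
  have hr := h.2 (x + 1)
  have hl := h.2 (x + -1)
  have up : ((column x (N x)).filter fun c => c + (0, 1) ∉ P).card = 1 := by
    rw [h.card_column_filter (0, 1) rfl, Finset.card_eq_one]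
    refine ⟨(1 - N x - x) / 2 + N x - 1, ?_⟩
    ext b
    simp only [Finset.mem_filter, Finset.mem_Ico, Finset.mem_singleton, add_zero]
    omega
  have down : ((column x (N x)).filter fun c => c + (0, -1) ∉ P).card = 1 := by
    rw [h.card_column_filter (0, -1) rfl, Finset.card_eq_one]
    refine ⟨(1 - N x - x) / 2, ?_⟩
    ext b
    simp only [Finset.mem_filter, Finset.mem_Ico, Finset.mem_singleton, add_zero]
    omega
  -- The neighbouring column is centred at the same height and has a size of the other parity. A
  -- shift by half a hexagon therefore leaves the two intervals nested.
  have r1 : ((column x (N x)).filter fun c => c + (1, 0) ∉ P).card = N x - N (x + 1) := by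
    rw [h.card_column_filter (1, 0) rfl]
    exact card_filter_not_mem_Ico (by dsimp only; omega)
  have r2 : ((column x (N x)).filter fun c => c + (1, -1) ∉ P).card = N x - N (x + 1) := by
    rw [h.card_column_filter (1, -1) rfl]
    exact card_filter_not_mem_Ico (by dsimp only; omega)
  have l1 : ((column x (N x)).filter fun c => c + (-1, 0) ∉ P).card = N x - N (x + -1) := by
    rw [h.card_column_filter (-1, 0) rfl]
    exact card_filter_not_mem_Ico (by dsimp only; omega)
  have l2 : ((column x (N x)).filter fun c => c + (-1, 1) ∉ P).card = N x - N (x + -1) := by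
    rw [h.card_column_filter (-1, 1) rfl]
    exact card_filter_not_mem_Ico (by dsimp only; omega)
  rw [hswap, steps, Finset.sum_insert (by decide), Finset.sum_insert (by decide),
    Finset.sum_insert (by decide), Finset.sum_insert (by decide), Finset.sum_insert (by decide),
    Finset.sum_singleton, up, down, r1, r2, l1, l2, ← sub_eq_add_neg]
  ring

/-- The total increase, an initial increase from `p` included. -/
def totalIncrease : ℕ → List ℕ → ℕ
  | _, [] => 0
  | p, n :: l => (n - p) + totalIncrease n l

/-- The walk starts at `p` and ends at zero, so its falls exceed its rises by `p`. -/
theorem add_totalIncrease (p : ℕ) (l : List ℕ) :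
    p + totalIncrease p l = totalDecrease (p :: l) := by
  induction l generalizing p with
  | nil => rfl
  | cons n l ih =>
    rw [totalIncrease, totalDecrease_cons, first_cons, ← ih]
    omega

theorem HasProfile.sum_cells {P : Finset Cell} {N : ℤ → ℕ} (h : HasProfile P N) {a : ℤ}
    {l : List ℕ} (hl : ∀ n ∈ l, 0 < n) (hN : ∀ x, a ≤ x → N x = colSize a l x) :
    ∑ c ∈ cells a l, (steps.filter fun e => c + e ∉ P).card
      = 2 * l.length + 2 * totalDecrease l + 2 * totalIncrease (N (a - 1)) l := by
  induction l generalizing a with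
  | nil => rfl
  | cons n l ih =>
    have e1 : N a = n := by rw [hN a le_rfl, colSize_self, first_cons]
    have e2 : N (a + 1) = first l := by
      rw [hN (a + 1) (by omega), colSize_cons_of_lt _ _ (by omega), colSize_self]
    have h1 := h.sum_column (x := a) (by rw [e1]; exact hl n (by simp))
    rw [e1, e2] at h1
    rw [cells, Finset.sum_union (disjoint_column_cells a n l (by omega)), h1,
      ih (fun k hk => hl k (by simp [hk])) fun x hx => by
        rw [hN x (by omega), colSize_cons_of_lt _ _ (by omega)],
      add_sub_cancel_right, e1, totalDecrease_cons, totalIncrease, List.length_cons]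
    ring

theorem perimeter_cells {a : ℤ} {l : List ℕ} (hl : l ∈ sizes) (ha : ((first l : ℤ) + a) % 2 = 1) :
    perimeter (cells a l) = 2 * half l := by
  have h := (hasProfile_cells hl ha).sum_cells hl.2.1 fun x _ => rfl
  rw [perimeter, h, colSize_of_lt l (by omega)]
  have h1 := add_totalIncrease 0 l
  rw [totalDecrease_cons] at h1
  rw [half]
  omega

/-! ### The shape of a sequence of column sizes -/

/-- The symmetric shape with the given column sizes. -/
noncomputable def shapeOf (l : List ℕ) : Shape :=
  Quotient.mk translationSetoid (cells (first l - 1) l)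

theorem mem_translate_iff {s c : Cell} {P : Finset Cell} : c ∈ translate s P ↔ c - s ∈ P := by
  rw [← mem_translate (s := s) (c := c - s), add_sub_cancel]

theorem hRefl_apply (c : Cell) : hRefl c = (c.1, -c.1 - c.2) := rfl

theorem vRefl_apply (c : Cell) : vRefl c = (-c.1, c.1 + c.2) := rfl

theorem hRefl_hRefl (c : Cell) : hRefl (hRefl c) = c := by
  ext <;> simp [hRefl_apply]

theorem vRefl_vRefl (c : Cell) : vRefl (vRefl c) = c := by
  ext <;> simp [vRefl_apply]

theorem mem_map_of_involutive {g : Cell ≃ₗ[ℤ] Cell} (hg : ∀ c, g (g c) = c) {P : Finset Cell}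
    {c : Cell} : c ∈ P.map g.toEquiv.toEmbedding ↔ g c ∈ P := by
  rw [Finset.mem_map]
  constructor
  · rintro ⟨d, hd, rfl⟩
    change g (g d) ∈ P
    rwa [hg]
  · intro h
    exact ⟨g c, h, hg c⟩

theorem mk_cells {a : ℤ} {l : List ℕ} (hl : l ∈ sizes) (ha : ((first l : ℤ) + a) % 2 = 1) :
    (Quotient.mk translationSetoid (cells a l) : Shape) = shapeOf l := by
  -- The horizontal shift is even by the parity condition on `a`, so the second coordinate makes the
  -- height of the translation vector zero.
  refine Quotient.sound (s := translationSetoid)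
    ⟨(first l - 1 - a, -((first l - 1 - a) / 2)), ?_⟩
  ext c
  rw [mem_translate_iff, (hasProfile_cells hl ha).1, (hasProfile_cells hl (by omega)).1]
  have h1 : height (c - (first l - 1 - a, -((first l - 1 - a) / 2))) = height c := by
    simp only [height, Prod.fst_sub, Prod.snd_sub]
    omega
  rw [h1, Prod.fst_sub, ← colSize_add a (first l - 1 - a), add_sub_cancel, sub_add_cancel]

theorem HasProfile.filter_eq_column {P : Finset Cell} {N : ℤ → ℕ} (h : HasProfile P N) {x : ℤ}
    (hx : 0 < N x) : (P.filter fun c => c.1 = x) = column x (N x) := by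
  ext c
  rw [Finset.mem_filter, mem_column (h.2 x hx), h.1]
  constructor
  · rintro ⟨h1, rfl⟩
    exact ⟨rfl, h1⟩
  · rintro ⟨rfl, h1⟩
    exact ⟨h1, rfl⟩

theorem HasProfile.card_filter {P : Finset Cell} {N : ℤ → ℕ} (h : HasProfile P N) (x : ℤ) :
    (P.filter fun c => c.1 = x).card = N x := by
  rcases Nat.eq_zero_or_pos (N x) with h0 | hpos
  · rw [h0, Finset.card_eq_zero, Finset.filter_eq_empty_iff]
    rintro c hc rfl
    rw [h.1, h0] at hc
    have := abs_nonneg (height c)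
    push_cast at hc
    omega
  · rw [h.filter_eq_column hpos]
    simp [column]

theorem HasProfile.exists_mem_iff {P : Finset Cell} {N : ℤ → ℕ} (h : HasProfile P N) (x : ℤ) :
    (∃ c ∈ P, c.1 = x) ↔ 0 < N x := by
  rw [← h.card_filter x, Finset.card_pos, Finset.filter_nonempty_iff]

/-! ### Parameters and symmetries of the shape of a sequence -/

section Statistics

variable {l : List ℕ}

theorem profile_shapeOf (hl : l ∈ sizes) :
    HasProfile (cells (first l - 1) l) (colSize (first l - 1) l) :=
  hasProfile_cells hl (by omega)

theorem length_pos_of_mem_sizes (hl : l ∈ sizes) : 0 < l.length :=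
  List.length_pos_iff.2 hl.1

theorem exists_mem_cells_iff (hl : l ∈ sizes) (x : ℤ) :
    (∃ c ∈ cells (first l - 1) l, c.1 = x) ↔ (first l : ℤ) - 1 ≤ x ∧ x < first l - 1 + l.length := by
  rw [(profile_shapeOf hl).exists_mem_iff, colSize_pos_iff hl.2.1]

theorem area_shapeOf (l : List ℕ) : (shapeOf l).area = l.sum := card_cells _ _

theorem halfPerimeter_shapeOf (hl : l ∈ sizes) : (shapeOf l).halfPerimeter = half l := by
  change perimeter (cells (first l - 1) l) / 2 = half l
  rw [perimeter_cells hl (by omega), Nat.mul_div_cancel_left _ two_pos]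

theorem width_shapeOf (hl : l ∈ sizes) : (shapeOf l).width = l.length := by
  change ((cells (first l - 1) l).image Prod.fst).card = l.length
  have : (cells (first l - 1) l).image Prod.fst
      = Finset.Ico ((first l : ℤ) - 1) (first l - 1 + l.length) := by
    ext x
    rw [Finset.mem_image, exists_mem_cells_iff hl, Finset.mem_Ico]
  rw [this, Int.card_Ico]
  omega

theorem firstSize_shapeOf (hl : l ∈ sizes) : (shapeOf l).firstSize = first l := by
  change (firstColumn (cells (first l - 1) l)).card = first l
  have hpos := length_pos_of_mem_sizes hl
  have : firstColumn (cells (first l - 1) l)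
      = (cells (first l - 1) l).filter fun c => c.1 = (first l : ℤ) - 1 := by
    refine Finset.filter_congr fun c hc => ?_
    have h1 := (exists_mem_cells_iff hl c.1).1 ⟨c, hc, rfl⟩
    constructor
    · intro h
      obtain ⟨d, hd, hdx⟩ := (exists_mem_cells_iff hl (first l - 1)).2 (by omega)
      have := h d hd
      omega
    · intro h d hd
      have h2 := (exists_mem_cells_iff hl d.1).1 ⟨d, hd, rfl⟩
      omega
  rw [this, (profile_shapeOf hl).card_filter, colSize_self]

theorem lastSize_shapeOf (hl : l ∈ sizes) : (shapeOf l).lastSize = last l := by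
  change (lastColumn (cells (first l - 1) l)).card = last l
  have hpos := length_pos_of_mem_sizes hl
  have : lastColumn (cells (first l - 1) l)
      = (cells (first l - 1) l).filter fun c => c.1 = (first l : ℤ) - 1 + l.length - 1 := by
    refine Finset.filter_congr fun c hc => ?_
    have h1 := (exists_mem_cells_iff hl c.1).1 ⟨c, hc, rfl⟩
    constructor
    · intro h
      obtain ⟨d, hd, hdx⟩ := (exists_mem_cells_iff hl (first l - 1 + l.length - 1)).2 (by omega)
      have := h d hd
      omega
    · intro h d hd
      have h2 := (exists_mem_cells_iff hl d.1).1 ⟨d, hd, rfl⟩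
      omega
  rw [this, (profile_shapeOf hl).card_filter, colSize_last]

theorem upper_shapeOf (hl : l ∈ sizes) : (shapeOf l).upper = {z | z ∈ diffs l} := by
  change upperGrowths (cells (first l - 1) l) = _
  rw [(profile_shapeOf hl).upperGrowths_eq]
  ext z
  exact mem_growths_colSize hl.2.1 z

theorem lower_shapeOf (hl : l ∈ sizes) : (shapeOf l).lower = {z | z ∈ diffs l} := by
  change lowerGrowths (cells (first l - 1) l) = _
  rw [(profile_shapeOf hl).lowerGrowths_eq]
  ext z
  exact mem_growths_colSize hl.2.1 z

theorem isConvexPolyomino_shapeOf (hl : l ∈ sizes) :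
    (shapeOf l).IsConvexPolyomino ↔ l ∈ convexSizes := by
  change Connected (cells (first l - 1) l) ∧ ConvexCells (cells (first l - 1) l) ↔ _
  rw [convexCells_cells_iff hl (by omega), and_iff_right]
  have hpos := length_pos_of_mem_sizes hl
  refine (profile_shapeOf hl).connected (x₀ := first l - 1) ?_ ?_
  · rw [colSize_pos_iff hl.2.1]
    omega
  · intro x₁ x x₂ h1 h2
    simp only [colSize_pos_iff hl.2.1]
    omega

theorem act_hRefl_shapeOf (hl : l ∈ sizes) : act hRefl (shapeOf l) = shapeOf l := by
  change (Quotient.mk translationSetoid _ : Shape) = Quotient.mk translationSetoid _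
  congr 1
  ext c
  rw [mem_map_of_involutive hRefl_hRefl, (profile_shapeOf hl).1, (profile_shapeOf hl).1]
  have : height (hRefl c) = -height c := by
    simp only [height, hRefl_apply]
    ring
  rw [this, abs_neg, hRefl_apply]

theorem sizes_last {a : ℤ} (hl : l ∈ sizes) (ha : ((first l : ℤ) + a) % 2 = 1) :
    ((last l : ℤ) + (a + l.length - 1)) % 2 = 1 := by
  have hpos := length_pos_of_mem_sizes hl
  rw [← colSize_last a l]
  refine (hasProfile_cells hl ha).2 _ ?_
  rw [colSize_pos_iff hl.2.1]
  omega

theorem act_vRefl_shapeOf (hl : l ∈ sizes) : act vRefl (shapeOf l) = shapeOf l.reverse := by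
  have h1 := sizes_last (a := first l - 1) hl (by omega)
  have h2 : ((first l.reverse : ℤ) + (1 - (first l - 1) - l.length)) % 2 = 1 := by
    rw [first_reverse]
    omega
  rw [← mk_cells (sizes_reverse.2 hl) h2]
  change (Quotient.mk translationSetoid _ : Shape) = Quotient.mk translationSetoid _
  congr 1
  ext c
  rw [mem_map_of_involutive vRefl_vRefl, (profile_shapeOf hl).1,
    (hasProfile_cells (sizes_reverse.2 hl) h2).1, colSize_reverse]
  have : height (vRefl c) = height c := by
    simp only [height, vRefl_apply]
    ring
  rw [this, vRefl_apply]

end Statistics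

/-- A translation preserves the number of cells in each column. The positive sizes occupy an
interval starting at a known abscissa, which fixes the horizontal shift. -/
theorem shapeOf_injOn : InjOn shapeOf sizes := by
  intro l hl l' hl' h
  obtain ⟨s, hs⟩ : ∃ s, cells (first l' - 1) l' = translate s (cells (first l - 1) l) :=
    Quotient.exact (s := translationSetoid) h
  have key : ∀ x, colSize (first l' - 1) l' (x + s.1) = colSize (first l - 1) l x := by
    intro x
    rw [← (profile_shapeOf hl).card_filter, ← (profile_shapeOf hl').card_filter, hs,
      filter_translate, translate, Finset.card_map]
    congr 1
    refine Finset.filter_congr fun c _ => ?_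
    rw [Prod.fst_add, add_comm, add_left_inj]
  have p1 := length_pos_of_mem_sizes hl
  have p2 := length_pos_of_mem_sizes hl'
  have q1 := (colSize_pos_iff (a := first l - 1) hl.2.1).2 ⟨le_rfl, by omega⟩
  have q2 := (colSize_pos_iff (a := first l' - 1) (x := first l' - 1 - s.1 + s.1) hl'.2.1).2
    ⟨by omega, by omega⟩
  rw [← key, colSize_pos_iff hl'.2.1] at q1
  rw [key, colSize_pos_iff hl.2.1] at q2
  have ha : (first l : ℤ) - 1 + s.1 = first l' - 1 := by omega
  refine colSize_injective (a := first l' - 1) hl.2.1 hl'.2.1 fun x => ?_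
  rw [← sub_add_cancel x s.1, key, ← ha, colSize_add]

/-! ### Every symmetric convex polyomino has such a shape -/

/-- The values of `N` at `w` consecutive integers. -/
def listOf (N : ℤ → ℕ) : ℤ → ℕ → List ℕ
  | _, 0 => []
  | a, w + 1 => N a :: listOf N (a + 1) w

theorem colSize_listOf (N : ℤ → ℕ) (a : ℤ) (w : ℕ) (x : ℤ) :
    colSize a (listOf N a w) x = if a ≤ x ∧ x < a + w then N x else 0 := by
  induction w generalizing a with
  | zero =>
    rw [listOf, colSize, if_neg]
    push_cast
    omega
  | succ w ih =>
    rw [listOf, colSize, ih]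
    push_cast
    by_cases h : x = a
    · rw [if_pos h, if_pos (by omega), h]
    · rw [if_neg h]
      congr 1
      rw [eq_iff_iff]
      omega

theorem listOf_mem_sizes {N : ℤ → ℕ} {a : ℤ} {w : ℕ}
    (hN : ∀ x, a ≤ x → x ≤ a + w → 0 < N x ∧ ((N x : ℤ) + x) % 2 = 1) :
    listOf N a (w + 1) ∈ sizes := by
  induction w generalizing a with
  | zero => exact singleton_mem_sizes.2 (hN a le_rfl (by simp)).1
  | succ w ih =>
    have h1 := hN a le_rfl (by omega)
    have h2 := hN (a + 1) (by omega) (by push_cast; omega)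
    exact mem_sizes_cons_cons.2 ⟨h1.1, by omega, ih fun x hx hx' => hN x (by omega)
      (by push_cast; omega)⟩

theorem sum_translate {P : Finset Cell} (s : Cell) (f : Cell → ℤ) :
    ∑ c ∈ translate s P, f c = ∑ c ∈ P, f (s + c) := by
  rw [translate, Finset.sum_map]
  rfl

/-- The reflection preserves the sum of the abscissae, whereas the translation adds `s.1` to it for
each cell. -/
theorem fst_eq_zero_of_hRefl {P : Finset Cell} (hP : P.Nonempty) {s : Cell}
    (hs : translate s P = P.map hRefl.toEquiv.toEmbedding) : s.1 = 0 := by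
  have h1 := sum_translate (P := P) s Prod.fst
  rw [hs, Finset.sum_map] at h1
  change ∑ c ∈ P, c.1 = _ at h1
  simp only [Prod.fst_add, Finset.sum_add_distrib, Finset.sum_const, nsmul_eq_mul] at h1
  have hne : (P.card : ℤ) ≠ 0 := by
    exact_mod_cast hP.card_pos.ne'
  have h2 : (P.card : ℤ) * s.1 = 0 := by linarith
  exact (mul_eq_zero.1 h2).resolve_left hne

theorem exists_hasProfile {Q : Finset Cell} (hQ : ConvexCells Q) (hh : ∀ c ∈ Q, hRefl c ∈ Q) :
    ∃ N, HasProfile Q N := by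
  have key : ∀ x : ℤ, ∃ n : ℕ, (∀ b, (x, b) ∈ Q ↔ |2 * b + x| < n) ∧ (0 < n → ((n : ℤ) + x) % 2 = 1) := by
    intro x
    by_cases hx : ∃ b, (x, b) ∈ Q
    · have hne : ((Q.filter fun c => c.1 = x).image Prod.snd).Nonempty := by
        obtain ⟨b, hb⟩ := hx
        exact ⟨b, by simp [hb]⟩
      have hmem : ∀ b, b ∈ (Q.filter fun c => c.1 = x).image Prod.snd ↔ (x, b) ∈ Q := by
        intro b
        simp only [Finset.mem_image, Finset.mem_filter]
        constructor
        · rintro ⟨⟨y, b'⟩, ⟨h1, rfl⟩, rfl⟩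
          exact h1
        · intro h
          exact ⟨_, ⟨h, rfl⟩, rfl⟩
      set m := ((Q.filter fun c => c.1 = x).image Prod.snd).min' hne with hm
      have hmQ : (x, m) ∈ Q := (hmem m).1 (Finset.min'_mem _ hne)
      have hle : ∀ b, (x, b) ∈ Q → m ≤ b := fun b hb => Finset.min'_le _ _ ((hmem b).2 hb)
      have hge : ∀ b, (x, b) ∈ Q → b ≤ -x - m := by
        intro b hb
        have := hle _ (hh _ hb)
        dsimp only at this
        omega
      have hmQ' := hh _ hmQ
      have hm2 := hle _ hmQ'
      dsimp only at hm2
      -- The reflection sends the lowest cell `m` of the column to the highest, `-x - m`, and this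
      -- is the number of integers between them.
      refine ⟨(1 - 2 * m - x).toNat, fun b => ?_, fun _ => by omega⟩
      rw [abs_lt]
      constructor
      · intro hb
        have := hle b hb
        have := hge b hb
        omega
      · intro hb
        have := (hQ (0, 1) (by simp) (x, 0)).out (x := m) (by simpa using hmQ)
          (y := -x - m) (by simpa [hRefl_apply] using hmQ') (show b ∈ Icc m (-x - m) from ⟨by omega, by omega⟩)
        simpa using this
    · push Not at hx
      refine ⟨0, fun b => ⟨fun h => absurd h (hx b), fun h => ?_⟩, fun h => absurd h (lt_irrefl _)⟩
      have := abs_nonneg (2 * b + x)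
      push_cast at h
      omega
  choose N hN hpar using key
  exact ⟨N, fun c => hN c.1 c.2, hpar⟩

theorem exists_shapeOf {P : Shape} (hP : P.IsConvexPolyomino) (hs : act hRefl P = P) :
    ∃ l ∈ convexSizes, shapeOf l = P := by
  induction P using Quotient.inductionOn with
  | _ P =>
  obtain ⟨s, hs⟩ : ∃ s, P.map hRefl.toEquiv.toEmbedding = translate s P := by
    obtain ⟨s, hs⟩ := Quotient.exact (s := translationSetoid) hs.symm
    exact ⟨s, hs⟩
  have hPconn : Connected P := hP.1
  obtain ⟨⟨c₀, hc₀⟩⟩ := hPconn.nonempty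
  have h0 := fst_eq_zero_of_hRefl ⟨c₀, hc₀⟩ hs.symm
  -- The vector `s` is vertical of height `2 * s.2`, so the axis of `P` lies at height `-s.2`. A
  -- shift of height `s.2` moves it to zero; it goes across columns because a vertical lattice
  -- vector has even height.
  set Q := translate (s.2, 0) P with hQdef
  have hQP : (Quotient.mk translationSetoid Q : Shape) = Quotient.mk translationSetoid P :=
    (Quotient.sound (s := translationSetoid) ⟨_, hQdef⟩).symm
  have hQconn : Connected Q := by
    rw [hQdef, connected_translate]
    exact hP.1
  have hQconv : ConvexCells Q := by
    rw [hQdef, convexCells_translate]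
    exact hP.2
  have hh : ∀ c ∈ Q, hRefl c ∈ Q := by
    intro c hc
    rw [hQdef, mem_translate_iff] at hc ⊢
    have h1 : hRefl (c - (s.2, 0)) ∈ P.map hRefl.toEquiv.toEmbedding := by
      rw [mem_map_of_involutive hRefl_hRefl, hRefl_hRefl]
      exact hc
    rw [hs, mem_translate_iff] at h1
    convert h1 using 1
    ext <;> simp [hRefl_apply, h0]
    ring
  obtain ⟨N, hN⟩ := exists_hasProfile hQconv hh
  obtain ⟨⟨c₁, hc₁⟩⟩ := hQconn.nonempty
  obtain ⟨cm, hcm, hmin⟩ := Q.exists_min_image Prod.fst ⟨c₁, hc₁⟩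
  obtain ⟨cM, hcM, hmax⟩ := Q.exists_max_image Prod.fst ⟨c₁, hc₁⟩
  have hNpos : ∀ x, 0 < N x ↔ cm.1 ≤ x ∧ x ≤ cM.1 := by
    intro x
    rw [← hN.exists_mem_iff]
    constructor
    · rintro ⟨c, hc, rfl⟩
      exact ⟨hmin c hc, hmax c hc⟩
    · rintro ⟨h1, h2⟩
      exact exists_column_of_connected hQconn hcm hcM h1 h2
  have hle := hmin cM hcM
  set w := (cM.1 - cm.1).toNat with hw
  have hl : listOf N cm.1 (w + 1) ∈ sizes := listOf_mem_sizes fun x h1 h2 => by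
    have h3 := (hNpos x).2 ⟨h1, by omega⟩
    exact ⟨h3, hN.2 x h3⟩
  have ha : ((first (listOf N cm.1 (w + 1)) : ℤ) + cm.1) % 2 = 1 :=
    hN.2 cm.1 ((hNpos _).2 ⟨le_rfl, hle⟩)
  have hcells : cells cm.1 (listOf N cm.1 (w + 1)) = Q := by
    ext c
    rw [(hasProfile_cells hl ha).1, hN.1, colSize_listOf]
    split_ifs with h
    · rfl
    · have : N c.1 = 0 := by
        by_contra hne
        have := (hNpos c.1).1 (Nat.pos_of_ne_zero hne)
        push_cast at h
        omega
      rw [this]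
  refine ⟨listOf N cm.1 (w + 1), ?_, ?_⟩
  · rwa [← convexCells_cells_iff hl ha, hcells]
  · rw [← mk_cells hl ha, hcells, hQP]

/-- Injectivity and surjectivity are the same for all classes; only the comparison of the defining
conditions remains. -/
theorem bijOn_shapeOf {B : Set (List ℕ)} {A : Set Shape} (hB : B ⊆ convexSizes)
    (hA : ∀ P ∈ A, P.IsConvexPolyomino ∧ act hRefl P = P)
    (h : ∀ l ∈ convexSizes, shapeOf l ∈ A ↔ l ∈ B) : BijOn shapeOf B A := by
  refine ⟨fun l hl => (h l (hB hl)).2 hl, shapeOf_injOn.mono fun l hl => (hB hl).1, fun P hP => ?_⟩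
  obtain ⟨l, hl, rfl⟩ := exists_shapeOf (hA P hP).1 (hA P hP).2
  exact ⟨l, (h l hl).1 hP, rfl⟩

/-! ### The symmetries -/

theorem act_mul (g g' : Cell ≃ₗ[ℤ] Cell) (P : Shape) : act (g * g') P = act g (act g' P) := by
  induction P using Quotient.inductionOn with
  | _ P =>
  change (Quotient.mk translationSetoid _ : Shape) = Quotient.mk translationSetoid _
  dsimp only
  rw [Finset.map_map]
  rfl

theorem act_one (P : Shape) : act 1 P = P := by
  induction P using Quotient.inductionOn with
  | _ P =>
  change (Quotient.mk translationSetoid _ : Shape) = Quotient.mk translationSetoid _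
  congr 1
  exact Finset.map_refl

/-- The cube of the rotation is the point reflection, which is the product of the two axial
reflections. -/
theorem D23_eq : D23 = Subgroup.closure {hRefl, vRefl} := by
  have h1 : rot ^ 3 = hRefl * vRefl := by
    ext c <;> simp [rot, hRefl, vRefl, pow_succ]
  have h2 : vRefl = hRefl * rot ^ 3 := by
    ext c <;> simp [rot, hRefl, vRefl, pow_succ]
  apply le_antisymm
  · rw [D23, Subgroup.closure_le]
    rintro g (rfl | rfl)
    · rw [h1]
      exact mul_mem (Subgroup.subset_closure (by simp)) (Subgroup.subset_closure (by simp))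
    · exact Subgroup.subset_closure (by simp)
  · rw [Subgroup.closure_le]
    rintro g (rfl | rfl)
    · exact Subgroup.subset_closure (by simp)
    · rw [h2]
      exact mul_mem (Subgroup.subset_closure (by simp)) (Subgroup.subset_closure (by simp))

theorem forall_D23_iff (P : Shape) :
    (∀ g ∈ D23, act g P = P) ↔ act hRefl P = P ∧ act vRefl P = P := by
  rw [D23_eq]
  constructor
  · intro h
    exact ⟨h _ (Subgroup.subset_closure (by simp)), h _ (Subgroup.subset_closure (by simp))⟩
  · rintro ⟨h1, h2⟩ g hg
    induction hg using Subgroup.closure_induction with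
    | mem g hg =>
      rcases hg with rfl | rfl
      · exact h1
      · exact h2
    | one => exact act_one P
    | mul g g' _ _ ih ih' => rw [act_mul, ih', ih]
    | inv g _ ih =>
      conv_lhs => rw [← ih]
      rw [← act_mul, inv_mul_cancel, act_one]

theorem act_hRefl_leftHalf (P : Shape) : act hRefl P.leftHalf = (act hRefl P).leftHalf := by
  induction P using Quotient.inductionOn with
  | _ P =>
  change (Quotient.mk translationSetoid _ : Shape) = Quotient.mk translationSetoid _
  congr 1
  ext c
  rw [mem_map_of_involutive hRefl_hRefl, leftHalfCells, leftHalfCells, Finset.mem_filter,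
    Finset.mem_filter, mem_map_of_involutive hRefl_hRefl]
  simp only [Finset.forall_mem_map]
  refine and_congr_right fun _ => ⟨?_, ?_⟩
  · rintro ⟨e, he, h⟩
    exact ⟨hRefl e, Finset.mem_map_of_mem _ he, h⟩
  · rintro ⟨e, he, h⟩
    exact ⟨hRefl e, (mem_map_of_involutive hRefl_hRefl).1 he, h⟩

theorem exists_translate_of_act {g : Cell ≃ₗ[ℤ] Cell} {P : Finset Cell}
    (h : act g (Quotient.mk translationSetoid P) = Quotient.mk translationSetoid P) :
    ∃ s, translate s P = P.map g.toEquiv.toEmbedding := by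
  obtain ⟨s, hs⟩ := Quotient.exact (s := translationSetoid) h.symm
  exact ⟨s, hs.symm⟩

theorem sub_mem_of_translate_eq {g : Cell ≃ₗ[ℤ] Cell} {P : Finset Cell} {s : Cell}
    (h : translate s P = P.map g.toEquiv.toEmbedding) {c : Cell} (hc : c ∈ P) : g c - s ∈ P := by
  rw [← mem_translate_iff, h]
  exact Finset.mem_map_of_mem _ hc

theorem hSymmetric_of_leftHalf {P : Shape} (hP : P.IsConvexPolyomino) (hv : act vRefl P = P)
    (hl : act hRefl P.leftHalf = P.leftHalf) : act hRefl P = P := by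
  induction P using Quotient.inductionOn with
  | _ P =>
  obtain ⟨⟨c₀, hc₀⟩⟩ := (show Connected P from hP.1).nonempty
  obtain ⟨s, hs⟩ := exists_translate_of_act hv
  obtain ⟨s', hs'⟩ := exists_translate_of_act (P := leftHalfCells P) hl
  obtain ⟨m, hm, hmin⟩ := P.exists_min_image Prod.fst ⟨c₀, hc₀⟩
  obtain ⟨M, hM, hmax⟩ := P.exists_max_image Prod.fst ⟨c₀, hc₀⟩
  have hsub : leftHalfCells P ⊆ P := Finset.filter_subset _ _
  have h0 : s'.1 = 0 := fst_eq_zero_of_hRefl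
    ⟨m, Finset.mem_filter.2 ⟨hm, m, hm, fun d hd => by linarith [hmin d hd]⟩⟩ hs'
  -- The vertical symmetry exchanges the extreme columns, so a cell to the right of the middle is
  -- sent to its left. The cell `M` of the last column is the witness in the definition of the left
  -- half.
  have hleft : ∀ c ∈ P, c ∈ leftHalfCells P ∨ vRefl c - s ∈ leftHalfCells P := by
    intro c hc
    by_cases hcl : c ∈ leftHalfCells P
    · exact Or.inl hcl
    · right
      simp only [leftHalfCells, Finset.mem_filter, not_and, not_exists] at hcl ⊢
      have h1 := hcl hc M hM
      push Not at h1
      obtain ⟨d, hd, hlt⟩ := h1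
      refine ⟨sub_mem_of_translate_eq hs hc, M, hM, fun d' hd' => ?_⟩
      have h2 := hmax _ (sub_mem_of_translate_eq hs hd)
      have h3 := hmax _ (sub_mem_of_translate_eq hs hd')
      simp only [Prod.fst_sub, vRefl_apply] at h2 h3 ⊢
      omega
  have hmem : ∀ c ∈ P, hRefl c - s' ∈ P := by
    intro c hc
    rcases hleft c hc with h | h
    · exact hsub (sub_mem_of_translate_eq hs' h)
    -- The cell is reflected to the left half, reflected there horizontally, and sent back. The two
    -- contributions of `s` cancel because `vRefl * hRefl` is the point reflection, and `vRefl`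
    -- fixes the vertical vector `s'`.
    · have h1 := sub_mem_of_translate_eq hs (hsub (sub_mem_of_translate_eq hs' h))
      convert h1 using 1
      ext <;> simp [hRefl_apply, vRefl_apply, h0]
      ring
  refine (Quotient.sound (s := translationSetoid) ⟨s', ?_⟩ : (Quotient.mk _ P : Shape) = _).symm
  refine Finset.eq_of_subset_of_card_le (fun c hc => ?_) ?_
  · rw [mem_map_of_involutive hRefl_hRefl] at hc
    rw [mem_translate_iff, ← hRefl_hRefl c]
    exact hmem _ hc
  · rw [translate, Finset.card_map, Finset.card_map]

theorem mem_fixD23_iff (P : Shape) : P ∈ fixD23 ↔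
    P.IsConvexPolyomino ∧ act vRefl P = P ∧ act hRefl P.leftHalf = P.leftHalf := by
  rw [fixD23, mem_ofPred_eq, forall_D23_iff]
  constructor
  · rintro ⟨h1, h2, h3⟩
    exact ⟨h1, h3, by rw [act_hRefl_leftHalf, h2]⟩
  · rintro ⟨h1, h2, h3⟩
    exact ⟨h1, hSymmetric_of_leftHalf h1 h2 h3, h2⟩

/-! ### The generating series as sums over sequences -/

theorem lastState_eq_zero {S : Set ℤ} : lastState S = 0 ↔ ∀ z ∈ S, ¬z < 0 := by
  rw [lastState]
  split_ifs with h1 h2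
  · obtain ⟨z, hz, hz1⟩ := h1
    simp only [false_iff]
    exact fun h => h z hz (by omega)
  · simp only [false_iff]
    obtain ⟨z, hz, hz1⟩ := h2
    exact fun h => h z hz hz1
  · push Not at h2
    simpa using h2

theorem lastState_eq_one {S : Set ℤ} :
    lastState S = 1 ↔ (∃ z ∈ S, z < 0) ∧ ∀ z ∈ S, ¬z < -1 := by
  rw [lastState]
  split_ifs with h1 h2
  · obtain ⟨z, hz, hz1⟩ := h1
    simp only [OfNat.ofNat_ne_one, false_iff]
    exact fun h => h.2 z hz hz1
  · simp only [true_iff]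
    push Not at h1 ⊢
    exact ⟨h2, h1⟩
  · simp [h2]

/-! ### The classes of shapes as sets of sequences -/

theorem bijOn_reverse {A B : Set (List ℕ)} (h : ∀ l, l.reverse ∈ B ↔ l ∈ A) :
    BijOn List.reverse A B :=
  ⟨fun l hl => (h l).2 hl, fun _ _ _ _ h => List.reverse_inj.1 h,
    fun l hl => ⟨l.reverse, (h _).1 (by rwa [List.reverse_reverse]), List.reverse_reverse l⟩⟩

theorem bijOn_classC_zero :
    BijOn shapeOf {l | l.reverse ∈ decSizes} (classC 0 0 ∩ hSymmetric) := by
  refine bijOn_shapeOf (fun l hl => (mem_decSizes_reverse.1 hl).1) (fun P hP => ⟨hP.1.1, hP.2⟩) ?_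
  intro l hl
  have h1 := (isConvexPolyomino_shapeOf hl.1).2 hl
  have h2 := act_hRefl_shapeOf hl.1
  simp only [classC, hSymmetric, mem_inter_iff, mem_ofPred_eq, h1, h2, upper_shapeOf hl.1,
    lower_shapeOf hl.1, lastState_eq_zero, mem_decSizes_reverse, hl, true_and, and_true, and_self]

theorem bijOn_classC_one : BijOn shapeOf weakSizes (classC 1 1 ∩ hSymmetric) := by
  refine bijOn_shapeOf (fun l hl => hl.1) (fun P hP => ⟨hP.1.1, hP.2⟩) ?_
  intro l hl
  have h1 := (isConvexPolyomino_shapeOf hl.1).2 hl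
  have h2 := act_hRefl_shapeOf hl.1
  simp only [classC, hSymmetric, mem_inter_iff, mem_ofPred_eq, h1, h2, upper_shapeOf hl.1,
    lower_shapeOf hl.1, lastState_eq_one, weakSizes, hl, true_and, and_true, and_self]

theorem bijOn_classH11 : BijOn shapeOf oscSizes (classH11 ∩ hSymmetric) := by
  refine bijOn_shapeOf oscSizes_subset (fun P hP => ⟨hP.1.1, hP.2⟩) ?_
  intro l hl
  have h1 := (isConvexPolyomino_shapeOf hl.1).2 hl
  have h2 := act_hRefl_shapeOf hl.1
  simp only [classH11, hSymmetric, mem_inter_iff, mem_ofPred_eq, h1, h2, upper_shapeOf hl.1,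
    lower_shapeOf hl.1, oscSizes, hl.1, true_and, and_true, and_self]

theorem bijOn_classT : BijOn shapeOf decSizes (classT ∩ hSymmetric) := by
  refine bijOn_shapeOf decSizes_subset (fun P hP => ⟨hP.1.1, hP.2⟩) ?_
  intro l hl
  have h1 := (isConvexPolyomino_shapeOf hl.1).2 hl
  have h2 := act_hRefl_shapeOf hl.1
  simp only [classT, hSymmetric, mem_inter_iff, mem_ofPred_eq, h1, h2, upper_shapeOf hl.1,
    lower_shapeOf hl.1, decSizes, hl.1, true_and, and_true, and_self]

theorem bijOn_fixD23 : BijOn shapeOf palindromes fixD23 := by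
  refine bijOn_shapeOf (fun l hl => hl.1)
    (fun P hP => ⟨hP.1, ((forall_D23_iff P).1 hP.2).1⟩) ?_
  intro l hl
  rw [fixD23, mem_ofPred_eq, forall_D23_iff, act_vRefl_shapeOf hl.1,
    shapeOf_injOn.eq_iff (sizes_reverse.2 hl.1) hl.1]
  simp only [isConvexPolyomino_shapeOf hl.1, act_hRefl_shapeOf hl.1, palindromes, mem_ofPred_eq,
    true_and]

/-- State 0 means increasing columns. The lists are indexed backwards, as decreasing ones, so the
last column appears as `first l`. -/
theorem hasSum_CS00 : HasSum (decSizes.indicator fun l =>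
    mon l.sum l.length 0 (first l) (half l)) CS00 := by
  have hb : BijOn (shapeOf ∘ List.reverse) decSizes (classC 0 0 ∩ hSymmetric) :=
    bijOn_classC_zero.comp (bijOn_reverse fun l => by rw [mem_ofPred_eq, List.reverse_reverse])
  refine hasSum_genSeries hb (fun l _ => ?_)
    (finite_subset_sizes (decSizes_subset.trans fun l hl => hl.1)) fun l hl => ?_
  · rw [Function.comp, area_shapeOf, List.sum_reverse]
  · have hs := sizes_reverse.2 hl.1
    rw [Function.comp, width_shapeOf hs, lastSize_shapeOf hs, halfPerimeter_shapeOf hs,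
      List.length_reverse, last_reverse, half_reverse, ← X_pow_eq, pow_zero, mul_one]

theorem hasSum_CS11 : HasSum (weakSizes.indicator fun l =>
    mon l.sum l.length 0 (last l) (half l)) CS11 := by
  refine hasSum_genSeries bijOn_classC_one (fun l _ => area_shapeOf l)
    (finite_subset_sizes fun l hl => hl.1.1) fun l hl => ?_
  rw [width_shapeOf hl.1.1, lastSize_shapeOf hl.1.1, halfPerimeter_shapeOf hl.1.1, ← X_pow_eq,
    pow_zero, mul_one]

theorem hasSum_HS11 : HasSum (oscSizes.indicator fun l =>
    mon l.sum l.length (first l) (last l) (half l)) HS11 := by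
  refine hasSum_genSeries bijOn_classH11 (fun l _ => area_shapeOf l)
    (finite_subset_sizes fun l hl => hl.1) fun l hl => ?_
  rw [width_shapeOf hl.1, firstSize_shapeOf hl.1, lastSize_shapeOf hl.1,
    halfPerimeter_shapeOf hl.1, ← X_pow_eq]

/-- The class is stable under reversal, so `u` and `v` play symmetric roles. This is the form in
which the functional equation, with `v` as catalytic variable, describes the addition of a first
column. -/
theorem hasSum_HS11_reverse : HasSum (oscSizes.indicator fun l =>
    mon l.sum l.length (last l) (first l) (half l)) HS11 := by
  rw [hasSum_bijOn (bijOn_reverse fun _ => oscSizes_reverse)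
    (g := fun l => mon l.sum l.length (first l) (last l) (half l))]
  · exact hasSum_HS11
  · intro l _
    rw [List.sum_reverse, List.length_reverse, first_reverse, last_reverse, half_reverse]

theorem hasSum_TS : HasSum (decSizes.indicator fun l => mon l.sum l.length (first l) 0 0) TS := by
  refine hasSum_genSeries bijOn_classT (fun l _ => area_shapeOf l)
    (finite_subset_sizes fun l hl => hl.1) fun l hl => ?_
  rw [width_shapeOf hl.1, firstSize_shapeOf hl.1, ← X_pow_eq, pow_zero, pow_zero, mul_one, mul_one]

theorem hasSum_fixSeries :
    HasSum (palindromes.indicator fun l => mon l.sum 0 0 0 (half l)) fixSeries := by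
  refine hasSum_genSeries bijOn_fixD23 (fun l _ => area_shapeOf l)
    (finite_subset_sizes fun l hl => hl.1.1) fun l hl => ?_
  rw [halfPerimeter_shapeOf hl.1.1, ← X_pow_eq, pow_zero, pow_zero, pow_zero, one_mul, one_mul,
    one_mul]

theorem extract_TS {k : ℕ} (hk : 1 ≤ k) : extract .u k TS = var .x * q ^ k * TS0 (k - 1) :=
  (extract_stacks hasSum_TS k).unique (hasSum_decSizes_first hk)

theorem functionalEquation_iff (F : Ser) : FunctionalEquation F ↔ F = HS11 := by
  have h := functionalEquation_of_hasSum hasSum_HS11_reverse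
  refine ⟨fun hF => functionalEquation_unique hF h, ?_⟩
  rintro rfl
  exact h

end HexPoly

theorem mainTheorem7 :
    -- `⟨r³, h⟩ = ⟨h, v⟩`
    HexPoly.D23 = Subgroup.closure {HexPoly.hRefl, HexPoly.vRefl} ∧
    -- a convex polyomino is fixed by `D_{2,3}` iff it is `v`-symmetric with `h`-symmetric left half
    (∀ P : HexPoly.Shape, P ∈ HexPoly.fixD23 ↔
      P.IsConvexPolyomino ∧ HexPoly.act HexPoly.vRefl P = P ∧
        HexPoly.act HexPoly.hRefl P.leftHalf = P.leftHalf) ∧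
    -- `CS_{00,k}(x,q,t) = t^{2k} TS_k(xt,q)`, and `TS_k(x,q) = x q^k TS0_{k-1}(x,q)`
    (∀ k ≥ 1, HexPoly.extract .v k HexPoly.CS00 =
        HexPoly.var .t ^ (2 * k) * HexPoly.substXT (HexPoly.extract .u k HexPoly.TS)) ∧
    (∀ k ≥ 1, HexPoly.extract .u k HexPoly.TS =
        HexPoly.var .x * HexPoly.q ^ k * HexPoly.TS0 (k - 1)) ∧
    -- `HS₁₁` is the unique solution of the functional equation
    (∀ F : HexPoly.Ser, HexPoly.FunctionalEquation F ↔ F = HexPoly.HS11) ∧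
    -- `CS₁₁ = ∑_{i ≥ 2} t^{-(2i-2)} CS_{00,i} HS_{11,i-1}`
    (∃ F : ℕ → HexPoly.Ser,
      (∀ i ≥ 2, HexPoly.var .t ^ (2 * i - 2) * F i =
        HexPoly.extract .v i HexPoly.CS00 * HexPoly.extract .u (i - 1) HexPoly.HS11) ∧
      HexPoly.HasFormalSum {i | 2 ≤ i} F HexPoly.CS11) ∧
    -- `|Fix(D_{2,3})| = ∑_{i ≥ 1} (CS_{00,i} + CS_{11,i})(1,q²,t²) / (q^i t^{2i+1})`
    (∃ F : ℕ → HexPoly.Ser,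
      (∀ i ≥ 1, HexPoly.q ^ i * HexPoly.var .t ^ (2 * i + 1) * F i =
        HexPoly.substOneSqSq
          (HexPoly.extract .v i HexPoly.CS00 + HexPoly.extract .v i HexPoly.CS11)) ∧
      HexPoly.HasFormalSum {i | 1 ≤ i} F HexPoly.fixSeries) := by
  exact ⟨HexPoly.D23_eq, HexPoly.mem_fixD23_iff,
    fun k _ => HexPoly.extract_eq_substXT HexPoly.hasSum_CS00 HexPoly.hasSum_TS k,
    fun _ hk => HexPoly.extract_TS hk, HexPoly.functionalEquation_iff,
    HexPoly.exists_formalSum_split HexPoly.hasSum_CS00 HexPoly.hasSum_HS11 HexPoly.hasSum_CS11,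
    HexPoly.exists_formalSum_palindromes HexPoly.hasSum_CS00 HexPoly.hasSum_CS11
      HexPoly.hasSum_fixSeries⟩
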